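/- A potential is a piecewise continuous function $u:\mathbb R\to\mathbb R$ that attains its maximum $\mathcal M(u)$ at a unique point $S(u)$. Given a potential $u$ and $w=(E,U)$ with $0<E<\infty$ and $0<U<1$, write $x_*=S(u)$, $\mathcal M=\mathcal M(u)$, let $z>0$ be the unique number with $\int_{x_*-z}^{x_*+z}(\mathcal M-u)\,dx=E$, put $a=\mathcal M-u(x_*-z)$, $b=\mathcal M-u(x_*+z)$, let $x^*=x_*-z$ if $U\in(0,\frac{a}{a+b}]$ and $x^*=x_*+z$ otherwise, and define $\mathcal H_w(u)$ to be equal to $\mathcal M+1$ at $x^*$, to $\mathcal M$ at the other points of $[x_*-z,x_*+z]$, and to $u$ elsewhere. Let $(E_n)_{n\ge1}$ and $(U_n)_{n\ge1}$ be independent i.i.d. sequences of standard exponential and of uniform $[0,1]$ random variables, respectively, and $w_n=(E_n,U_n)$. Let $u_0^0(x)=\mathbf 1_{\{x=0\}}-1$, $u_n^0=\mathcal H_{w_n}(u_{n-1}^0)$ and $S_n=S(u_n^0)$; almost surely, all these steps are well defined. Let $\nu$ be a Poisson point process with unit intensity on $\mathbb R\times(-1,\infty)$, a point $(x,t)\in\nu$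 being a customer that arrives at the place $x$ at time $t$. The greedy server with service time $T=1$ and speed $v=\infty$ starts at the origin; at each time $n=0,1,2,\dots$ it jumps instantaneously to the nearest customer that has arrived by time $n$ and has not been served before, stays there during $[n,n+1)$, and that customer leaves at time $n+1$. Almost surely, the nearest customer exists and is unique at every such time. Let $\mathcal S_t$ be the position of the server at time $t$ and $\mathcal S_{t-}$ its left limit. Then the sequence $(S_n)_{n=1,2,\dots}$ has the same distribution as the sequence $(\mathcal S_{t-})_{t=1,2,\dots}$. -/

import Mathlib

open MeasureTheory ProbabilityTheory Set Filter
open scoped Topology ENNReal NNReal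

noncomputable section

namespace GreedyServer

/-! ### Potentials and the operators `𝓗_w` -/

/-- A potential: a piecewise continuous function `ℝ → ℝ` (finitely many discontinuities in every
bounded interval, finite one-sided limits everywhere) that attains its maximum at a unique
point. -/
structure IsPotential (u : ℝ → ℝ) : Prop where
  finite_discontinuities : ∀ a b : ℝ, {x ∈ Icc a b | ¬ ContinuousAt u x}.Finite
  exists_left_limit : ∀ x : ℝ, ∃ l : ℝ, Tendsto u (𝓝[<] x) (𝓝 l)
  exists_right_limit : ∀ x : ℝ, ∃ l : ℝ, Tendsto u (𝓝[>] x) (𝓝 l)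
  existsUnique_max : ∃! x : ℝ, ∀ y : ℝ, u y ≤ u x

/-- `S(u)`: the point where `u` attains its maximum. -/
def argMax (u : ℝ → ℝ) : ℝ := Classical.epsilon fun x : ℝ => ∀ y : ℝ, u y ≤ u x

/-- `𝓜(u)`: the maximum of `u`. -/
def maxVal (u : ℝ → ℝ) : ℝ := u (argMax u)

/-- `z > 0` and the area between `u` and its maximum over `[S(u) - z, S(u) + z]` is `e`. -/
def IsRadius (u : ℝ → ℝ) (e z : ℝ) : Prop :=
  0 < z ∧ ∫ x in (argMax u - z)..(argMax u + z), (maxVal u - u x) = e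

/-- The number `z` in the definition of `𝓗_w(u)`, for `w = (e, _)`. -/
def radius (u : ℝ → ℝ) (e : ℝ) : ℝ := Classical.epsilon (IsRadius u e)

/-- The point `x^*` in the definition of `𝓗_w(u)`: with `a` and `b` the depths of `u` below its
maximum at the two ends of the interval, the left end if `w.2 ∈ (0, a / (a + b)]`, otherwise the
right end. -/
def nextPoint (w : ℝ × ℝ) (u : ℝ → ℝ) : ℝ :=
  let z := radius u w.1
  let a := maxVal u - u (argMax u - z)
  let b := maxVal u - u (argMax u + z)
  open Classical in
  if w.2 ∈ Ioc 0 (a / (a + b)) then argMax u - z else argMax u + z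

/-- The operator `𝓗_w`, for `w = (E, U)`. -/
def stepOp (w : ℝ × ℝ) (u : ℝ → ℝ) : ℝ → ℝ := fun x =>
  open Classical in
  if x = nextPoint w u then maxVal u + 1
  else if x ∈ Icc (argMax u - radius u w.1) (argMax u + radius u w.1) then maxVal u
  else u x

/-- The initial potential `δ_0 - 1`: value `0` at the origin and `-1` elsewhere. -/
def initialPotential : ℝ → ℝ := fun x => open Classical in (if x = 0 then 1 else 0) - 1

/-- The potentials `u_0 = δ_0 - 1`, `u_{n+1} = 𝓗_{w_{n+1}}(u_n)`; the sequence `w` is indexed from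
`0` here, so that the pair `w n` produces `u_{n+1}`. -/
def potentialSeq (w : ℕ → ℝ × ℝ) : ℕ → ℝ → ℝ
  | 0 => initialPotential
  | n + 1 => stepOp (w n) (potentialSeq w n)

/-! ### Poisson point processes -/

/-- The random set `ν` of points of `X` is a Poisson point process with intensity measure `Λ`:
the number of points in each measurable set is a random variable, Poisson distributed with mean
`Λ A` whenever this is finite, and the numbers of points in finitely many disjoint measurable sets
are independent. -/
structure IsPoissonProcess {Ω X : Type*} [MeasurableSpace Ω] [MeasurableSpace X]
    (ν : Ω → Set X) (Λ : Measure X) (P : Measure Ω) : Prop where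
  measurable_count : ∀ A : Set X, MeasurableSet A → Measurable fun ω => (ν ω ∩ A).encard
  law_count : ∀ A : Set X, MeasurableSet A → Λ A ≠ ∞ → ∀ k : ℕ,
    P {ω | (ν ω ∩ A).encard = k} = poissonMeasure (Λ A).toNNReal {k}
  indep_count : ∀ (m : ℕ) (A : Fin m → Set X), (∀ i, MeasurableSet (A i)) →
    Pairwise (fun i j => Disjoint (A i) (A j)) →
    iIndepFun (fun i ω => (ν ω ∩ A i).encard) P

/-- Lebesgue measure on the space-time half-plane `ℝ × (-1, ∞)`. -/
def spaceTimeIntensity : Measure (ℝ × ℝ) :=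
  (volume : Measure (ℝ × ℝ)).restrict (univ ×ˢ Ioi (-1))

/-! ### The greedy server with unit service times and infinite speed

A customer is a point `(x, t)`: it arrives at the place `x` at time `t`. The server starts at the
origin. Since travelling takes no time and every service takes one unit of time, the server chooses
a new customer at each of the times `0, 1, 2, …`, and the service begun at time `n` ends at
time `n + 1`, when the customer leaves. -/

/-- The customers of `ν` that have arrived by time `t` and are not among those in `served`. -/
def waiting (ν served : Set (ℝ × ℝ)) (t : ℝ) : Set (ℝ × ℝ) := {p ∈ ν | p.2 ≤ t ∧ p ∉ served}

/-- `p` is a waiting customer at minimal distance from the place `s`. -/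
def IsNearest (ν served : Set (ℝ × ℝ)) (t s : ℝ) (p : ℝ × ℝ) : Prop :=
  p ∈ waiting ν served t ∧ ∀ q ∈ waiting ν served t, |p.1 - s| ≤ |q.1 - s|

/-- The position of the server immediately before its choice at time `n`, and the set of the
customers served before time `n`. -/
def serverState (ν : Set (ℝ × ℝ)) : ℕ → ℝ × Set (ℝ × ℝ)
  | 0 => (0, ∅)
  | n + 1 =>
    let s := serverState ν n
    let p : ℝ × ℝ := Classical.epsilon (IsNearest ν s.2 n s.1)
    (p.1, insert p s.2)

/-- The position `S_t` of the server at time `t`: the origin before time `0`, and on `[n, n + 1)`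
the place of the customer chosen at time `n`. -/
def serverPosition (ν : Set (ℝ × ℝ)) (t : ℝ) : ℝ :=
  if t < 0 then 0 else (serverState ν (⌊t⌋₊ + 1)).1

end GreedyServer

end

noncomputable section

namespace GreedyServer

/-! ### Histories and explored regions -/

/-! The potential at time `n` records what the server has searched. Off the current position, and
above time `-1`, the space-time region explored before time `n` is the part below the graph of the
potential (`mem_explored_iff`). The customers that have arrived but are unexplored over `y`
therefore fill a time interval whose length is the depth `h y` of the potential below its maximum.
From the position `s`, the Poisson property suggests that the next place has density `h y * exp
(-area)`, where the area is that under `h` over the points at distance at most `|y - s|` from `s`.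
The operator `𝓗_w` produces exactly this law: the exponential variable is the area reached, and the
uniform variable picks a side with probability proportional to the depth there
(`IsDepth.lintegral_nextPos`).

Conditioning on the past of the Poisson process is avoided by comparing joint densities. The
candidate density of the first `n` customers served, with respect to the `n`-fold product of the
intensity, is `servedDensity`: the indicator of admissibility times the probability that the
explored region is void. Void probabilities multiply along the steps (`voidProb_explored_succ`), so
induction shows that the chain of maximum points is the image of this density (`lintegral_chain`).
In particular its total mass is one.

For the server a lower bound suffices. Space-time is cut into thin cells. The events that prescribed
cells contain one customer each, and that the rest of a slightly enlarged explored region is empty,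
are disjoint and have explicit Poisson probabilities. Fatou's lemma bounds the law of the places
from below by the density on open sets (`lintegral_servedDensity_le_liminf`). Since the mass is
already one, nothing is lost: the greedy rule almost surely determines a unique customer, the places
are almost everywhere measurable, and the two laws agree (`map_serverPlaces_eq`). Equality of the
laws of all initial segments then gives equality of the laws of the sequences. -/

/-- The sequence `0, x 0, …, x (n - 1)`, continued by zeros. -/
def path {n : ℕ} (x : Fin n → ℝ) : ℕ → ℝ
  | 0 => 0
  | i + 1 => if h : i < n then x ⟨i, h⟩ else 0

lemma path_zero {n : ℕ} (x : Fin n → ℝ) : path x 0 = 0 := rfl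

lemma path_succ {n : ℕ} (x : Fin n → ℝ) (i : Fin n) : path x (i + 1) = x i := by
  simp [path]

lemma path_snoc {n : ℕ} (x : Fin n → ℝ) (y : ℝ) {i : ℕ} (hi : i ≤ n) :
    path (Fin.snoc x y : Fin (n + 1) → ℝ) i = path x i := by
  cases i with
  | zero => rfl
  | succ i => simp [path, Fin.snoc, show i < n by omega, show i < n + 1 by omega]

lemma path_snoc_last {n : ℕ} (x : Fin n → ℝ) (y : ℝ) :
    path (Fin.snoc x y : Fin (n + 1) → ℝ) (n + 1) = y := by
  simp [path, Fin.snoc]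

lemma abs_path_sub_le {n : ℕ} {x y : Fin n → ℝ} {δ : ℝ} (hδ : 0 ≤ δ)
    (h : ∀ i, |x i - y i| ≤ δ) (i : ℕ) : |path x i - path y i| ≤ δ := by
  cases i with
  | zero => simpa [path] using hδ
  | succ i =>
    by_cases hi : i < n
    · simpa [path, hi] using h ⟨i, hi⟩
    · simpa [path, hi] using hδ

@[fun_prop]
lemma measurable_path {n : ℕ} (i : ℕ) : Measurable fun x : Fin n → ℝ => path x i := by
  cases i with
  | zero => exact measurable_const
  | succ i =>
    by_cases hi : i < n
    · simpa [path, hi] using measurable_pi_apply (X := fun _ : Fin n => ℝ) ⟨i, hi⟩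
    · simp [path, hi]

lemma measurable_path_pi {n : ℕ} : Measurable fun x : Fin n → ℝ => path x :=
  measurable_pi_iff.2 measurable_path

/-- The space-time region searched by a server that is at `x i` just before its choice at time
`i < n`, with the search radii enlarged by `r`. -/
def explored (r : ℝ) (n : ℕ) (x : ℕ → ℝ) : Set (ℝ × ℝ) :=
  {q | ∃ i < n, |q.1 - x i| ≤ |x (i + 1) - x i| + r ∧ q.2 ≤ i}

lemma explored_congr {r : ℝ} {n : ℕ} {x y : ℕ → ℝ} (h : ∀ i ≤ n, x i = y i) :
    explored r n x = explored r n y := by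
  ext q
  refine exists_congr fun i => and_congr_right fun hi => ?_
  rw [h i hi.le, h (i + 1) hi]

lemma explored_mono {r r' : ℝ} (hr : r ≤ r') {m n : ℕ} (hmn : m ≤ n) (x : ℕ → ℝ) :
    explored r m x ⊆ explored r' n x :=
  fun _ ⟨i, hi, h, ht⟩ => ⟨i, hi.trans_le hmn, h.trans (by linarith), ht⟩

lemma explored_succ (r : ℝ) (n : ℕ) (x : ℕ → ℝ) :
    explored r (n + 1) x =
      explored r n x ∪ {q | |q.1 - x n| ≤ |x (n + 1) - x n| + r ∧ q.2 ≤ n} := by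
  ext q
  constructor
  · rintro ⟨i, hi, h⟩
    rcases Nat.lt_succ_iff_lt_or_eq.1 hi with hi | rfl
    · exact Or.inl ⟨i, hi, h⟩
    · exact Or.inr h
  · rintro (⟨i, hi, h⟩ | h)
    · exact ⟨i, hi.trans n.lt_succ_self, h⟩
    · exact ⟨n, n.lt_succ_self, h⟩

/-- Moving the path by `δ` shifts each centre by at most `δ` and changes each search radius by at
most `2 * δ`. -/
lemma explored_subset {r δ : ℝ} {n : ℕ} {x y : ℕ → ℝ} (h : ∀ i, |x i - y i| ≤ δ) :
    explored r n x ⊆ explored (r + 3 * δ) n y := by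
  rintro q ⟨i, hi, hq, ht⟩
  refine ⟨i, hi, ?_, ht⟩
  have h1 := abs_le.1 (h i)
  have h2 := abs_le.1 (h (i + 1))
  have h3 : |q.1 - y i| ≤ |q.1 - x i| + |x i - y i| := abs_sub_le _ _ _
  have h4 : |x (i + 1) - x i| ≤ |x (i + 1) - y (i + 1)| + |y (i + 1) - x i| := abs_sub_le _ _ _
  have h5 : |y (i + 1) - x i| ≤ |y (i + 1) - y i| + |y i - x i| := abs_sub_le _ _ _
  rw [abs_sub_comm (y i)] at h5
  linarith [h i, h (i + 1)]

lemma measurableSet_explored_prod (r : ℝ) (n : ℕ) :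
    MeasurableSet {a : (ℕ → ℝ) × (ℝ × ℝ) | a.2 ∈ explored r n a.1} := by
  have : {a : (ℕ → ℝ) × (ℝ × ℝ) | a.2 ∈ explored r n a.1} = ⋃ i, ⋃ (_ : i < n),
      {a | |a.2.1 - a.1 i| ≤ |a.1 (i + 1) - a.1 i| + r ∧ a.2.2 ≤ (i : ℝ)} := by
    ext a; simp only [explored, mem_ofPred_eq, mem_iUnion, exists_prop]
  rw [this]
  refine MeasurableSet.iUnion fun i => MeasurableSet.iUnion fun _ => ?_
  have h1 : MeasurableSet {a : (ℕ → ℝ) × (ℝ × ℝ) | |a.2.1 - a.1 i| ≤ |a.1 (i + 1) - a.1 i| + r} :=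
    measurableSet_le (by fun_prop) (by fun_prop)
  have h2 : MeasurableSet {a : (ℕ → ℝ) × (ℝ × ℝ) | a.2.2 ≤ (i : ℝ)} :=
    measurableSet_le (by fun_prop) (by fun_prop)
  exact h1.inter h2

lemma measurableSet_explored (r : ℝ) (n : ℕ) (x : ℕ → ℝ) : MeasurableSet (explored r n x) :=
  measurable_prodMk_left (measurableSet_explored_prod r n)

/-- The customers `p 0, …, p (n - 1)` can be served in this order at the times `0, …, n - 1`: each
of them has arrived by then, and none of them has been passed over before. -/
def IsAdmissible {n : ℕ} (p : Fin n → ℝ × ℝ) : Prop :=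
  ∀ i : Fin n, (p i).2 ≤ (i : ℕ) ∧ p i ∉ explored 0 i (path fun j => (p j).1)

/-! ### The run of the server -/

/-- The customer chosen at time `n`. -/
def chosen (ν : Set (ℝ × ℝ)) (n : ℕ) : ℝ × ℝ :=
  Classical.epsilon (IsNearest ν (serverState ν n).2 n (serverState ν n).1)

lemma serverState_succ (ν : Set (ℝ × ℝ)) (n : ℕ) :
    serverState ν (n + 1) = ((chosen ν n).1, insert (chosen ν n) (serverState ν n).2) := rfl

/-- A waiting customer at least as near as `p i` lies in the layer explored at time `i`, so it is
some `p j`. It was already served if `j < i`, and admissibility of `p j` forbids `i < j`. The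
inequality is not strict, so ties are excluded as well. -/
lemma isNearest_iff_of_isAdmissible {ν : Set (ℝ × ℝ)} {n : ℕ} {p : Fin n → ℝ × ℝ}
    (hp : ∀ i, p i ∈ ν) (hadm : IsAdmissible p)
    (hν : ν ∩ explored 0 n (path fun j => (p j).1) ⊆ range p) (i : ℕ) (hi : i ≤ n) :
    serverState ν i = (path (fun j => (p j).1) i, {q | ∃ j : Fin n, j < i ∧ q = p j}) ∧
    ∀ h : i < n, ∀ q, IsNearest ν (serverState ν i).2 i (serverState ν i).1 q ↔ q = p ⟨i, h⟩ := by
  set x := path fun j => (p j).1 with hx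
  have hxs : ∀ j : Fin n, x (j + 1) = (p j).1 := fun j => path_succ _ j
  have hmem : ∀ (j : Fin n) (k : ℕ), j < k → p j ∈ explored 0 k x := fun j k hjk =>
    ⟨j, hjk, by rw [hxs, add_zero], (hadm j).1⟩
  have key : ∀ i : ℕ, serverState ν i = (x i, {q | ∃ j : Fin n, j < i ∧ q = p j}) →
      ∀ h : i < n, ∀ q,
        IsNearest ν (serverState ν i).2 i (serverState ν i).1 q ↔ q = p ⟨i, h⟩ := by
    intro i hst h q
    have hpw : p ⟨i, h⟩ ∈ waiting ν (serverState ν i).2 i := by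
      refine ⟨hp _, (hadm ⟨i, h⟩).1, ?_⟩
      rw [hst]
      rintro ⟨j, hj, hpj⟩
      exact (hadm ⟨i, h⟩).2 (hpj ▸ hmem j i hj)
    have hclose : ∀ q ∈ waiting ν (serverState ν i).2 i,
        |q.1 - x i| ≤ |(p ⟨i, h⟩).1 - x i| → q = p ⟨i, h⟩ := by
      intro q hq hd
      have hqe : |q.1 - x i| ≤ |x (i + 1) - x i| + 0 ∧ q.2 ≤ i :=
        ⟨by rw [hxs ⟨i, h⟩, add_zero]; exact hd, hq.2.1⟩
      obtain ⟨j, rfl⟩ := hν ⟨hq.1, i, h, hqe⟩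
      have h1 : ¬ (j : ℕ) < i := fun hj => hq.2.2 (by rw [hst]; exact ⟨j, hj, rfl⟩)
      have h2 : ¬ i < (j : ℕ) := fun hj => (hadm j).2 ⟨i, hj, hqe⟩
      exact congrArg p (Fin.ext (show (j : ℕ) = i by omega))
    have hst1 : (serverState ν i).1 = x i := by rw [hst]
    constructor
    · intro hq
      exact hclose q hq.1 (by simpa [hst1] using hq.2 _ hpw)
    · rintro rfl
      refine ⟨hpw, fun q hq => ?_⟩
      rw [hst1]
      by_contra! hlt
      have := hclose q hq hlt.le
      rw [this] at hlt
      exact lt_irrefl _ hlt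
  have hstate : ∀ i ≤ n, serverState ν i = (x i, {q | ∃ j : Fin n, j < i ∧ q = p j}) := by
    intro i
    induction i with
    | zero => intro _; simp [serverState, hx, path_zero]
    | succ i ih =>
      intro hi
      have ih := ih (by omega)
      have hc : chosen ν i = p ⟨i, hi⟩ := by
        rw [← key i ih hi]
        exact Classical.epsilon_spec ⟨_, (key i ih hi _).2 rfl⟩
      rw [serverState_succ, hc, ih]
      refine Prod.ext (hxs ⟨i, hi⟩).symm ?_
      ext q
      simp only [mem_insert_iff, mem_ofPred_eq]
      constructor
      · rintro (rfl | ⟨j, hj, rfl⟩)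
        · exact ⟨⟨i, hi⟩, by simp, rfl⟩
        · exact ⟨j, by omega, rfl⟩
      · rintro ⟨j, hj, rfl⟩
        rcases Nat.lt_succ_iff_lt_or_eq.1 hj with hj | hj
        · exact Or.inr ⟨j, hj, rfl⟩
        · left; congr 1; exact Fin.ext hj
  exact ⟨hstate i hi, key i (hstate i hi)⟩

lemma leftLim_serverPosition (ν : Set (ℝ × ℝ)) (n : ℕ) :
    Function.leftLim (serverPosition ν) ((n : ℝ) + 1) = (serverState ν (n + 1)).1 := by
  refine leftLim_eq_of_tendsto (tendsto_const_nhds.congr' ?_)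
  filter_upwards [Ioo_mem_nhdsLT (show (n : ℝ) < n + 1 by linarith)] with t ht
  have h0 : 0 ≤ t := (Nat.cast_nonneg n).trans ht.1.le
  have : ⌊t⌋₊ = n := (Nat.floor_eq_iff h0).2 ⟨ht.1.le, ht.2⟩
  simp [serverPosition, not_lt.2 h0, this]

/-! ### One step from a point `s` with depth function `h` -/

lemma expMeasure_nonpos : expMeasure 1 {e | ¬ 0 < e} = 0 := by
  have hle : {e : ℝ | ¬ 0 < e} = Iic 0 := by ext; simp
  rw [hle, expMeasure, gammaMeasure, withDensity_apply _ measurableSet_Iic]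
  exact lintegral_gammaPDF_of_nonpos le_rfl ▸ setLIntegral_congr Iio_ae_eq_Iic.symm

/-- The conditions on the depth `h` of a potential below its maximum, attained at `s`. -/
structure IsDepth (h : ℝ → ℝ) (s C : ℝ) : Prop where
  measurable : Measurable h
  nonneg : ∀ y, 0 ≤ h y
  le : ∀ y, h y ≤ C
  one_le : ∀ y, y ≠ s → 1 ≤ h y

/-- The area under `h` over `[s - z, s + z]`. -/
def symmArea (h : ℝ → ℝ) (s z : ℝ) : ℝ := ∫ y in (s - z)..(s + z), h y

/-- The half-width of the interval about `s` over which the area under `h` is `e`. -/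
def halfWidth (h : ℝ → ℝ) (s e : ℝ) : ℝ :=
  open Classical in if 0 < e then Classical.epsilon fun z => 0 < z ∧ symmArea h s z = e else 0

/-- The next point for the pair `w = (e, u)`: the left end of the interval if `u` is small. -/
def nextPos (h : ℝ → ℝ) (s : ℝ) (w : ℝ × ℝ) : ℝ :=
  open Classical in
  if w.2 ∈ Ioc 0 (h (s - halfWidth h s w.1) /
    (h (s - halfWidth h s w.1) + h (s + halfWidth h s w.1)))
  then s - halfWidth h s w.1 else s + halfWidth h s w.1

namespace IsDepth

variable {h : ℝ → ℝ} {s C : ℝ}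

lemma intervalIntegrable (hh : IsDepth h s C) (a b : ℝ) : IntervalIntegrable h volume a b := by
  refine (intervalIntegrable_const (c := C)).mono_fun hh.measurable.aestronglyMeasurable ?_
  refine Eventually.of_forall fun y => ?_
  beta_reduce
  rw [Real.norm_of_nonneg (hh.nonneg y)]
  exact (hh.le y).trans (le_abs_self C)

/-- Folding the line at `s` makes the area a primitive of the paired depth, which is at least `2` on
the positive axis. -/
lemma symmArea_sub (hh : IsDepth h s C) (a b : ℝ) :
    symmArea h s b - symmArea h s a = ∫ t in a..b, (h (s - t) + h (s + t)) := by
  have h1 := hh.intervalIntegrable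
  have i1 : IntervalIntegrable (fun t => h (s - t)) volume a b := by
    simpa using (h1 (s - a) (s - b)).comp_sub_left s
  have i2 : IntervalIntegrable (fun t => h (s + t)) volume a b := by
    simpa using (h1 (s + a) (s + b)).comp_add_left s
  rw [intervalIntegral.integral_add i1 i2, intervalIntegral.integral_comp_sub_left (fun y => h y),
    intervalIntegral.integral_comp_add_left (fun y => h y), symmArea, symmArea,
    ← intervalIntegral.integral_add_adjacent_intervals (h1 (s - b) (s - a)) (h1 (s - a) (s + b)),
    ← intervalIntegral.integral_add_adjacent_intervals (h1 (s - a) (s + a)) (h1 (s + a) (s + b))]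
  ring

lemma symmArea_zero : symmArea h s 0 = 0 := by simp [symmArea]

lemma measurable_pair (hh : IsDepth h s C) : Measurable fun t => h (s - t) + h (s + t) :=
  (hh.measurable.comp (by fun_prop)).add (hh.measurable.comp (by fun_prop))

lemma intervalIntegrable_pair (hh : IsDepth h s C) (a b : ℝ) :
    IntervalIntegrable (fun t => h (s - t) + h (s + t)) volume a b := by
  refine (intervalIntegrable_const (c := C + C)).mono_fun
    hh.measurable_pair.aestronglyMeasurable ?_
  refine Eventually.of_forall fun t => ?_
  have h1 := hh.nonneg (s - t)
  have h2 := hh.nonneg (s + t)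
  beta_reduce
  rw [Real.norm_of_nonneg (add_nonneg h1 h2)]
  exact (add_le_add (hh.le _) (hh.le _)).trans (le_abs_self _)

lemma two_le (hh : IsDepth h s C) {t : ℝ} (ht : 0 < t) : 2 ≤ h (s - t) + h (s + t) := by
  have h1 := hh.one_le (s - t) (by linarith)
  have h2 := hh.one_le (s + t) (by linarith)
  linarith

lemma continuous_symmArea (hh : IsDepth h s C) : Continuous (symmArea h s) := by
  have : symmArea h s = fun z => ∫ t in 0..z, (h (s - t) + h (s + t)) := by
    ext z; rw [← hh.symmArea_sub, symmArea_zero, sub_zero]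
  rw [this]
  exact intervalIntegral.continuous_primitive hh.intervalIntegrable_pair 0

lemma le_symmArea_sub (hh : IsDepth h s C) {a b : ℝ} (ha : 0 ≤ a) (hab : a ≤ b) :
    2 * (b - a) ≤ symmArea h s b - symmArea h s a := by
  rw [hh.symmArea_sub]
  have : ∫ _ in a..b, (2 : ℝ) = 2 * (b - a) := by simp [mul_comm]
  rw [← this]
  refine intervalIntegral.integral_mono_on_of_le_Ioo hab intervalIntegrable_const
    (hh.intervalIntegrable_pair a b) fun t ht => hh.two_le (ha.trans_lt ht.1)

lemma strictMonoOn_symmArea (hh : IsDepth h s C) : StrictMonoOn (symmArea h s) (Ici 0) := by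
  intro a ha b _ hab
  have := hh.le_symmArea_sub ha hab.le
  linarith

lemma symmArea_nonneg (hh : IsDepth h s C) {z : ℝ} (hz : 0 ≤ z) : 0 ≤ symmArea h s z := by
  have := hh.le_symmArea_sub le_rfl hz
  rw [symmArea_zero] at this
  linarith

lemma existsUnique_symmArea_eq (hh : IsDepth h s C) {e : ℝ} (he : 0 < e) :
    ∃! z, 0 < z ∧ symmArea h s z = e := by
  -- The area grows at rate at least `2`, so the radius `e` is more than enough and bounds the
  -- search.
  have h1 : e ≤ symmArea h s e := by
    have := hh.le_symmArea_sub le_rfl he.le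
    rw [symmArea_zero] at this
    linarith
  obtain ⟨z, hz, hze⟩ := intermediate_value_Icc he.le hh.continuous_symmArea.continuousOn
    (show e ∈ Icc (symmArea h s 0) (symmArea h s e) from ⟨by rw [symmArea_zero]; exact he.le, h1⟩)
  have hz0 : 0 < z := by
    rcases hz.1.eq_or_lt with rfl | h
    · rw [symmArea_zero] at hze; linarith
    · exact h
  exact ⟨z, ⟨hz0, hze⟩, fun y hy =>
    hh.strictMonoOn_symmArea.injOn hy.1.le hz0.le (hy.2.trans hze.symm)⟩

lemma halfWidth_spec (hh : IsDepth h s C) {e : ℝ} (he : 0 < e) :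
    0 < halfWidth h s e ∧ symmArea h s (halfWidth h s e) = e := by
  rw [halfWidth, if_pos he]
  exact Classical.epsilon_spec (hh.existsUnique_symmArea_eq he).exists

lemma halfWidth_nonneg (hh : IsDepth h s C) (e : ℝ) : 0 ≤ halfWidth h s e := by
  by_cases he : 0 < e
  · exact (hh.halfWidth_spec he).1.le
  · rw [halfWidth, if_neg he]

lemma symmArea_halfWidth (hh : IsDepth h s C) {e : ℝ} (he : 0 ≤ e) :
    symmArea h s (halfWidth h s e) = e := by
  rcases he.eq_or_lt with rfl | he
  · simp [halfWidth, symmArea_zero]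
  · exact (hh.halfWidth_spec he).2

lemma halfWidth_symmArea (hh : IsDepth h s C) {z : ℝ} (hz : 0 ≤ z) :
    halfWidth h s (symmArea h s z) = z :=
  hh.strictMonoOn_symmArea.injOn (hh.halfWidth_nonneg _) hz
    (hh.symmArea_halfWidth (hh.symmArea_nonneg hz))

/-- `halfWidth` is defined by choice, so its measurability is read off from this description of its
sublevel sets. The default value `0` makes it valid for `e ≤ 0` too. -/
lemma halfWidth_le_iff (hh : IsDepth h s C) {e r : ℝ} (hr : 0 ≤ r) :
    halfWidth h s e ≤ r ↔ e ≤ symmArea h s r := by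
  by_cases he : 0 ≤ e
  · rw [← hh.strictMonoOn_symmArea.le_iff_le (hh.halfWidth_nonneg e) hr, hh.symmArea_halfWidth he]
  · push Not at he
    rw [halfWidth, if_neg he.le.not_gt]
    exact iff_of_true hr (he.le.trans (hh.symmArea_nonneg hr))

end IsDepth

/-- Joint measurability of the next point in the depth function and in the pair `w`. -/
lemma measurable_nextPos {X : Type*} [MeasurableSpace X] {h : X → ℝ → ℝ} {s C : X → ℝ}
    (hs : Measurable s) (hm : Measurable fun a : X × ℝ => h a.1 a.2)
    (hh : ∀ x, IsDepth (h x) (s x) (C x)) :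
    Measurable fun a : X × (ℝ × ℝ) => nextPos (h a.1) (s a.1) a.2 := by
  have harea : ∀ r, Measurable fun x => symmArea (h x) (s x) r := by
    intro r
    have : (fun x => symmArea (h x) (s x) r) =
        fun x => ∫ t in 0..r, (h x (s x - t) + h x (s x + t)) := by
      ext x; rw [← (hh x).symmArea_sub, IsDepth.symmArea_zero, sub_zero]
    rw [this]
    have hp : Measurable fun a : X × ℝ => h a.1 (s a.1 - a.2) + h a.1 (s a.1 + a.2) :=
      (hm.comp (measurable_fst.prodMk ((hs.comp measurable_fst).sub measurable_snd))).add
        (hm.comp (measurable_fst.prodMk ((hs.comp measurable_fst).add measurable_snd)))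
    simp only [intervalIntegral]
    exact (hp.stronglyMeasurable.integral_prod_right (ν := volume.restrict (Ioc 0 r))).measurable.sub
      (hp.stronglyMeasurable.integral_prod_right (ν := volume.restrict (Ioc r 0))).measurable
  have hz : Measurable fun a : X × (ℝ × ℝ) => halfWidth (h a.1) (s a.1) a.2.1 := by
    refine measurable_of_Iic fun r => ?_
    by_cases hr : 0 ≤ r
    · have : (fun a : X × (ℝ × ℝ) => halfWidth (h a.1) (s a.1) a.2.1) ⁻¹' Iic r =
          {a | a.2.1 ≤ symmArea (h a.1) (s a.1) r} := by
        ext a; exact (hh a.1).halfWidth_le_iff hr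
      rw [this]
      exact measurableSet_le (by fun_prop) ((harea r).comp measurable_fst)
    · have : (fun a : X × (ℝ × ℝ) => halfWidth (h a.1) (s a.1) a.2.1) ⁻¹' Iic r = ∅ := by
        ext a
        simp only [mem_preimage, mem_Iic, mem_empty_iff_false, iff_false]
        exact fun h' => hr (((hh a.1).halfWidth_nonneg _).trans h')
      rw [this]
      exact MeasurableSet.empty
  have hs' : Measurable fun a : X × (ℝ × ℝ) => s a.1 := hs.comp measurable_fst
  have hl := hs'.sub hz
  have hr := hs'.add hz
  have hhl := hm.comp (measurable_fst.prodMk hl)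
  have hhr := hm.comp (measurable_fst.prodMk hr)
  have hu : Measurable fun a : X × (ℝ × ℝ) => a.2.2 := by fun_prop
  refine Measurable.ite ?_ hl hr
  exact (measurableSet_lt measurable_const hu).inter (measurableSet_le hu (hhl.div (hhl.add hhr)))

namespace IsDepth

variable {h : ℝ → ℝ} {s C : ℝ}

lemma measurable_halfWidth (hh : IsDepth h s C) : Measurable (halfWidth h s) := by
  refine measurable_of_Iic fun r => ?_
  by_cases hr : 0 ≤ r
  · have : halfWidth h s ⁻¹' Iic r = Iic (symmArea h s r) := by
      ext e; exact hh.halfWidth_le_iff hr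
    rw [this]
    exact measurableSet_Iic
  · have : halfWidth h s ⁻¹' Iic r = ∅ := by
      ext e
      simp only [mem_preimage, mem_Iic, mem_empty_iff_false, iff_false]
      exact fun h' => hr ((hh.halfWidth_nonneg _).trans h')
    rw [this]
    exact MeasurableSet.empty

/-- The map `symmArea h s` turns the density `h (s - z) + h (s + z)` on `(0, ∞)` into Lebesgue
measure. -/
lemma map_symmArea (hh : IsDepth h s C) :
    ((volume.restrict (Ioi 0)).withDensity
      fun z => ENNReal.ofReal (h (s - z) + h (s + z))).map (symmArea h s) =
      volume.restrict (Ioi 0) := by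
  symm
  -- The depth is only measurable, so the change of variables is checked on intervals instead of by
  -- a derivative. Monotonicity makes the preimage of an interval an interval, after truncating the
  -- end points at `0`.
  refine Measure.ext_of_Ioc _ _ fun a b hab => ?_
  have hc := hh.continuous_symmArea.measurable
  rw [Measure.map_apply hc measurableSet_Ioc,
    withDensity_apply _ (hc measurableSet_Ioc), Measure.restrict_restrict (hc measurableSet_Ioc),
    Measure.restrict_apply measurableSet_Ioc]
  have e1 : Ioc a b ∩ Ioi 0 = Ioc (max a 0) (max b 0) := by
    ext y
    simp only [mem_inter_iff, mem_Ioc, mem_Ioi, max_lt_iff, le_max_iff]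
    grind
  have ha0 : (0 : ℝ) ≤ max a 0 := le_max_right _ _
  have hb0 : (0 : ℝ) ≤ max b 0 := le_max_right _ _
  have e2 : symmArea h s ⁻¹' Ioc a b ∩ Ioi 0 =
      Ioc (halfWidth h s (max a 0)) (halfWidth h s (max b 0)) := by
    ext z
    simp only [mem_inter_iff, mem_preimage, mem_Ioc, mem_Ioi]
    constructor
    · rintro ⟨⟨h1, h2⟩, hz⟩
      have hp : 0 < symmArea h s z := by
        have := hh.strictMonoOn_symmArea self_mem_Ici hz.le hz
        rwa [symmArea_zero] at this
      refine ⟨lt_of_not_ge fun hle => ?_, ?_⟩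
      · rw [← hh.strictMonoOn_symmArea.le_iff_le hz.le (hh.halfWidth_nonneg _),
          hh.symmArea_halfWidth ha0] at hle
        exact absurd hle (not_le.2 (max_lt h1 hp))
      · rw [← hh.strictMonoOn_symmArea.le_iff_le hz.le (hh.halfWidth_nonneg _),
          hh.symmArea_halfWidth hb0]
        exact h2.trans (le_max_left _ _)
    · rintro ⟨h1, h2⟩
      have hz := (hh.halfWidth_nonneg _).trans_lt h1
      rw [← hh.strictMonoOn_symmArea.lt_iff_lt (hh.halfWidth_nonneg _) hz.le,
        hh.symmArea_halfWidth ha0] at h1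
      rw [← hh.strictMonoOn_symmArea.le_iff_le hz.le (hh.halfWidth_nonneg _),
        hh.symmArea_halfWidth hb0] at h2
      have h3 := max_lt_iff.1 h1
      refine ⟨⟨h3.1, ?_⟩, hz⟩
      rcases le_max_iff.1 h2 with h | h
      · exact h
      · linarith
  have hle : halfWidth h s (max a 0) ≤ halfWidth h s (max b 0) := by
    rw [hh.halfWidth_le_iff (hh.halfWidth_nonneg _), hh.symmArea_halfWidth hb0]
    exact max_le_max hab.le le_rfl
  have hnn : ∀ t, 0 ≤ h (s - t) + h (s + t) := fun t => add_nonneg (hh.nonneg _) (hh.nonneg _)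
  rw [e1, e2, Real.volume_Ioc, ← ofReal_integral_eq_lintegral_ofReal
    ((intervalIntegrable_iff_integrableOn_Ioc_of_le hle).1 (hh.intervalIntegrable_pair _ _))
    (Eventually.of_forall hnn), ← intervalIntegral.integral_of_le hle, ← hh.symmArea_sub,
    hh.symmArea_halfWidth ha0, hh.symmArea_halfWidth hb0]

/-- Substitute `e = symmArea h s z` in the exponential integral; the paired depth is the Jacobian.
-/
lemma lintegral_exp_halfWidth (hh : IsDepth h s C) {K : ℝ → ℝ≥0∞} (hK : Measurable K) :
    ∫⁻ e, K (halfWidth h s e) ∂(expMeasure 1) =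
      ∫⁻ z in Ioi 0, ENNReal.ofReal (h (s - z) + h (s + z)) *
        (ENNReal.ofReal (Real.exp (-symmArea h s z)) * K z) := by
  have hpdf : ∀ e ∈ Ioi (0 : ℝ), gammaPDF 1 1 e * K (halfWidth h s e) =
      ENNReal.ofReal (Real.exp (-e)) * K (halfWidth h s e) := by
    intro e he
    have := exponentialPDF_of_nonneg (r := 1) (le_of_lt he)
    rw [exponentialPDF, exponentialPDFReal] at this
    rw [gammaPDF, this]
    simp
  have hzero : ∀ e ∈ Iio (0 : ℝ), gammaPDF 1 1 e * K (halfWidth h s e) = 0 := by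
    intro e he
    rw [gammaPDF_of_neg he, zero_mul]
  have hKw : Measurable fun e => K (halfWidth h s e) := hK.comp hh.measurable_halfWidth
  have hm1 : Measurable fun e => ENNReal.ofReal (Real.exp (-e)) * K (halfWidth h s e) :=
    (by fun_prop : Measurable fun e : ℝ => ENNReal.ofReal (Real.exp (-e))).mul hKw
  have hpd : Measurable (gammaPDF 1 1) := (measurable_gammaPDFReal 1 1).ennreal_ofReal
  rw [expMeasure, gammaMeasure, lintegral_withDensity_eq_lintegral_mul _ hpd hKw]
  simp only [Pi.mul_apply]
  rw [← lintegral_add_compl _ (measurableSet_Iio (a := (0 : ℝ))),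
    setLIntegral_congr_fun measurableSet_Iio hzero, compl_Iio, lintegral_zero, zero_add,
    setLIntegral_congr Ioi_ae_eq_Ici.symm, setLIntegral_congr_fun measurableSet_Ioi hpdf]
  have hm2 : Measurable fun z => ENNReal.ofReal (Real.exp (-symmArea h s z)) *
      K (halfWidth h s (symmArea h s z)) := hm1.comp hh.continuous_symmArea.measurable
  conv_lhs => rw [← hh.map_symmArea, lintegral_map hm1 hh.continuous_symmArea.measurable,
    lintegral_withDensity_eq_lintegral_mul _ hh.measurable_pair.ennreal_ofReal hm2]
  refine setLIntegral_congr_fun measurableSet_Ioi fun z hz => ?_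
  simp only [Pi.mul_apply, hh.halfWidth_symmArea (le_of_lt hz)]

/-- The law of the next point has density `y ↦ h y * exp (- area up to y)`. -/
lemma lintegral_nextPos (hh : IsDepth h s C) {g : ℝ → ℝ≥0∞} (hg : Measurable g) :
    ∫⁻ w, g (nextPos h s w) ∂((expMeasure 1).prod (volume.restrict (Icc (0 : ℝ) 1))) =
      ∫⁻ y, ENNReal.ofReal (h y) * (ENNReal.ofReal (Real.exp (-symmArea h s |y - s|)) * g y) := by
  have hnm : Measurable (nextPos h s) :=
    (measurable_nextPos (X := Unit) (h := fun _ => h) (s := fun _ => s) (C := fun _ => C)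
      measurable_const (hh.measurable.comp measurable_snd) fun _ => hh).comp
      (measurable_const (a := ()) |>.prodMk measurable_id)
  have hgn : Measurable fun w => g (nextPos h s w) := hg.comp hnm
  rw [lintegral_prod _ hgn.aemeasurable]
  -- The average of `g` over the uniform variable when the half-width is `z`.
  set K : ℝ → ℝ≥0∞ := fun z =>
    ENNReal.ofReal (h (s - z) / (h (s - z) + h (s + z))) * g (s - z) +
      ENNReal.ofReal (h (s + z) / (h (s - z) + h (s + z))) * g (s + z) with hKdef
  have hml : Measurable fun z => h (s - z) := hh.measurable.comp (by fun_prop)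
  have hmr : Measurable fun z => h (s + z) := hh.measurable.comp (by fun_prop)
  have hgl : Measurable fun z => g (s - z) := hg.comp (by fun_prop)
  have hgr : Measurable fun z => g (s + z) := hg.comp (by fun_prop)
  have hK : Measurable K :=
    ((hml.div (hml.add hmr)).ennreal_ofReal.mul hgl).add
      ((hmr.div (hml.add hmr)).ennreal_ofReal.mul hgr)
  have hinner : ∀ᵐ e ∂(expMeasure 1),
      ∫⁻ u in Icc (0 : ℝ) 1, g (nextPos h s (e, u)) = K (halfWidth h s e) := by
    have hpos : ∀ᵐ e ∂(expMeasure 1), 0 < e := ae_iff.2 expMeasure_nonpos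
    filter_upwards [hpos] with e he
    set z := halfWidth h s e with hz
    have hz0 : 0 < z := (hh.halfWidth_spec he).1
    have ha := hh.one_le (s - z) (by linarith)
    have hb := hh.one_le (s + z) (by linarith)
    set c := h (s - z) / (h (s - z) + h (s + z)) with hc
    have hc0 : 0 ≤ c := by positivity
    have hc1 : c ≤ 1 := by rw [hc, div_le_one (by positivity)]; linarith
    -- The value `u = 0`, which the rule sends to the right end, is negligible.
    have hsplit : (Icc (0 : ℝ) 1 : Set ℝ) =ᵐ[volume] (Ioc 0 c ∪ Ioc c 1 : Set ℝ) := by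
      rw [Ioc_union_Ioc_eq_Ioc hc0 hc1]
      exact Ioc_ae_eq_Icc.symm
    have e1 : ∀ u ∈ Ioc 0 c, g (nextPos h s (e, u)) = g (s - z) := by
      intro u hu
      rw [nextPos, if_pos hu]
    have e2 : ∀ u ∈ Ioc c 1, g (nextPos h s (e, u)) = g (s + z) := by
      intro u hu
      rw [nextPos, if_neg fun h' => absurd h'.2 (not_le.2 hu.1)]
    rw [setLIntegral_congr hsplit, lintegral_union measurableSet_Ioc
      (by rw [Set.disjoint_left]; intro u hu hu'; exact absurd hu.2 (not_le.2 hu'.1)),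
      setLIntegral_congr_fun measurableSet_Ioc e1, setLIntegral_congr_fun measurableSet_Ioc e2]
    have h1c : 1 - c = h (s + z) / (h (s - z) + h (s + z)) := by
      rw [hc]; field_simp; ring
    simp only [lintegral_const, Measure.restrict_apply MeasurableSet.univ, univ_inter,
      Real.volume_Ioc, sub_zero, h1c, hKdef]
    ring
  rw [lintegral_congr_ae hinner, hh.lintegral_exp_halfWidth hK]
  set F : ℝ → ℝ≥0∞ := fun y =>
    ENNReal.ofReal (h y) * (ENNReal.ofReal (Real.exp (-symmArea h s |y - s|)) * g y) with hF
  have hFm : Measurable F := hh.measurable.ennreal_ofReal.mul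
    (((Real.measurable_exp.comp (hh.continuous_symmArea.measurable.comp
      (by fun_prop : Measurable fun y : ℝ => |y - s|)).neg).ennreal_ofReal).mul hg)
  -- The Jacobian cancels the normalisation of the side probabilities, so each end keeps its own
  -- depth as weight. The two summands are then the two half-lines of the final integral.
  have hz : ∀ z ∈ Ioi (0 : ℝ), ENNReal.ofReal (h (s - z) + h (s + z)) *
      (ENNReal.ofReal (Real.exp (-symmArea h s z)) * K z) = F (s - z) + F (s + z) := by
    intro z hz
    have hz' : (0 : ℝ) < z := hz
    have h2 := hh.two_le hz'
    have e1 : ENNReal.ofReal (h (s - z) + h (s + z)) *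
        ENNReal.ofReal (h (s - z) / (h (s - z) + h (s + z))) = ENNReal.ofReal (h (s - z)) := by
      rw [← ENNReal.ofReal_mul (by linarith)]; congr 1; field_simp
    have e2 : ENNReal.ofReal (h (s - z) + h (s + z)) *
        ENNReal.ofReal (h (s + z) / (h (s - z) + h (s + z))) = ENNReal.ofReal (h (s + z)) := by
      rw [← ENNReal.ofReal_mul (by linarith)]; congr 1; field_simp
    simp only [hF, hKdef]
    rw [show s - z - s = -z by ring, show s + z - s = z by ring, abs_neg, abs_of_pos hz',
      ← e1, ← e2]
    ring
  have hFl : Measurable fun z => F (s - z) := hFm.comp (by fun_prop)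
  rw [setLIntegral_congr_fun measurableSet_Ioi hz, lintegral_add_left hFl,
    ← lintegral_add_compl F (measurableSet_Iio (a := s)), compl_Iio,
    setLIntegral_congr Ioi_ae_eq_Ici.symm]
  congr 1
  · have := (Measure.measurePreserving_sub_left (volume : Measure ℝ) s).setLIntegral_comp_preimage
      (measurableSet_Iio (a := s)) hFm
    rw [← this]
    congr 2
    ext z; simp
  · have := (measurePreserving_add_left (volume : Measure ℝ) s).setLIntegral_comp_preimage
      (measurableSet_Ioi (a := s)) hFm
    rw [← this]
    congr 2
    ext z; simp

end IsDepth

/-! ### Potentials determined by the sequence of their maximum points -/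

/-- The potential at time `n` when the maximum points at the times `0, …, n` are `x 0, …, x n`. -/
def pathPotential (x : ℕ → ℝ) : ℕ → ℝ → ℝ
  | 0 => initialPotential
  | n + 1 => fun y =>
    open Classical in
    if y = x (n + 1) then (n : ℝ) + 1
    else if |y - x n| ≤ |x (n + 1) - x n| then n
    else pathPotential x n y

lemma pathPotential_congr {n : ℕ} {x x' : ℕ → ℝ} (h : ∀ i ≤ n, x i = x' i) :
    pathPotential x n = pathPotential x' n := by
  induction n with
  | zero => rfl
  | succ n ih =>
    ext y
    simp only [pathPotential, h (n + 1) le_rfl, h n n.le_succ,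
      ih fun i hi => h i (hi.trans n.le_succ)]

lemma pathPotential_self {x : ℕ → ℝ} (h0 : x 0 = 0) (n : ℕ) : pathPotential x n (x n) = n := by
  cases n with
  | zero => simp [pathPotential, initialPotential, h0]
  | succ n => simp [pathPotential]

/-- The previous peak lies in the interval levelled by the next step, so it does not survive unless
the maximum point stays put. Hence the current peak always stands at least `1` above everything
else. -/
lemma pathPotential_le {x : ℕ → ℝ} (h0 : x 0 = 0) (n : ℕ) {y : ℝ} (hy : y ≠ x n) :
    pathPotential x n y ≤ n - 1 := by
  induction n with
  | zero =>
    rw [h0] at hy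
    simp [pathPotential, initialPotential, hy]
  | succ n ih =>
    simp only [pathPotential, hy, if_false]
    split_ifs with h
    · simp
    · have hy' : y ≠ x n := by rintro rfl; simp at h
      have := ih hy'
      push_cast
      linarith

lemma neg_one_le_pathPotential (x : ℕ → ℝ) (n : ℕ) (y : ℝ) : -1 ≤ pathPotential x n y := by
  induction n with
  | zero => simp only [pathPotential, initialPotential]; split_ifs <;> simp
  | succ n ih =>
    have := Nat.cast_nonneg (α := ℝ) n
    simp only [pathPotential]
    split_ifs <;> linarith

lemma isMax_pathPotential_iff {x : ℕ → ℝ} (h0 : x 0 = 0) (n : ℕ) (y : ℝ) :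
    (∀ t, pathPotential x n t ≤ pathPotential x n y) ↔ y = x n := by
  constructor
  · intro h
    by_contra hy
    have h1 := h (x n)
    have h2 := pathPotential_le h0 n hy
    rw [pathPotential_self h0] at h1
    linarith
  · rintro rfl t
    by_cases ht : t = x n
    · rw [ht]
    · have := pathPotential_le h0 n ht
      rw [pathPotential_self h0]
      linarith

lemma argMax_pathPotential {x : ℕ → ℝ} (h0 : x 0 = 0) (n : ℕ) :
    argMax (pathPotential x n) = x n := by
  rw [← isMax_pathPotential_iff h0]
  exact Classical.epsilon_spec
    (p := fun y => ∀ t, pathPotential x n t ≤ pathPotential x n y)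
    ⟨x n, (isMax_pathPotential_iff h0 n _).2 rfl⟩

lemma maxVal_pathPotential {x : ℕ → ℝ} (h0 : x 0 = 0) (n : ℕ) :
    maxVal (pathPotential x n) = n := by
  rw [maxVal, argMax_pathPotential h0, pathPotential_self h0]

/-- Redefining a function as a constant on a closed interval preserves piecewise continuity. -/
lemma piecewiseContinuous_ite {f : ℝ → ℝ}
    (hf : (∀ a b : ℝ, {x ∈ Icc a b | ¬ ContinuousAt f x}.Finite) ∧
      (∀ x, ∃ l, Tendsto f (𝓝[<] x) (𝓝 l)) ∧ ∀ x, ∃ l, Tendsto f (𝓝[>] x) (𝓝 l))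
    (c r v : ℝ) {g : ℝ → ℝ} (hin : ∀ y, |y - c| ≤ r → g y = v)
    (hout : ∀ y, ¬ |y - c| ≤ r → g y = f y) :
    (∀ a b : ℝ, {x ∈ Icc a b | ¬ ContinuousAt g x}.Finite) ∧
      (∀ x, ∃ l, Tendsto g (𝓝[<] x) (𝓝 l)) ∧ ∀ x, ∃ l, Tendsto g (𝓝[>] x) (𝓝 l) := by
  -- A one-sided neighbourhood of any point is eventually inside or eventually outside the interval.
  have lim : ∀ l : Filter ℝ, (∃ a, Tendsto f l (𝓝 a)) →
      ((∀ᶠ t in l, |t - c| ≤ r) ∨ ∀ᶠ t in l, ¬ |t - c| ≤ r) → ∃ a, Tendsto g l (𝓝 a) := by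
    rintro l ⟨a, ha⟩ (h | h)
    · exact ⟨v, tendsto_const_nhds.congr' (h.mono fun t ht => (hin t ht).symm)⟩
    · exact ⟨a, ha.congr' (h.mono fun t ht => (hout t ht).symm)⟩
  refine ⟨fun a b => ?_, fun x => lim _ (hf.2.1 x) ?_, fun x => lim _ (hf.2.2 x) ?_⟩
  · refine ((hf.1 a b).union (toFinite {c - r, c + r})).subset ?_
    rintro x ⟨hx, hgx⟩
    by_contra hcon
    simp only [mem_union, mem_ofPred_eq, mem_insert_iff, mem_singleton_iff, not_or, not_and,
      not_not] at hcon
    obtain ⟨h1, h2, h3⟩ := hcon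
    refine hgx ?_
    rcases lt_trichotomy |x - c| r with h | h | h
    · have : ∀ᶠ t in 𝓝 x, |t - c| < r :=
        (by fun_prop : Continuous fun t => |t - c|).continuousAt.eventually_lt_const h
      exact continuousAt_const.congr (this.mono fun t ht => (hin t ht.le).symm)
    · rcases abs_eq (h ▸ abs_nonneg _) |>.1 h with h | h
      · exact absurd (by linarith) h3
      · exact absurd (by linarith) h2
    · have : ∀ᶠ t in 𝓝 x, r < |t - c| :=
        (by fun_prop : Continuous fun t => |t - c|).continuousAt.eventually_const_lt h
      exact (h1 hx).congr (this.mono fun t ht => (hout t (not_le.2 ht)).symm)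
  · by_cases h1 : x ≤ c - r
    · right
      filter_upwards [self_mem_nhdsWithin] with t ht hle
      have ht' : t < x := ht
      linarith [(abs_le.1 hle).1]
    by_cases h2 : x ≤ c + r
    · left
      filter_upwards [Ioo_mem_nhdsLT (not_le.1 h1)] with t ht
      exact abs_le.2 ⟨by linarith [ht.1], by linarith [ht.2]⟩
    · right
      filter_upwards [Ioo_mem_nhdsLT (not_le.1 h2)] with t ht hle
      linarith [(abs_le.1 hle).2, ht.1]
  · by_cases h1 : c + r ≤ x
    · right
      filter_upwards [self_mem_nhdsWithin] with t ht hle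
      have ht' : x < t := ht
      linarith [(abs_le.1 hle).2]
    by_cases h2 : c - r ≤ x
    · left
      filter_upwards [Ioo_mem_nhdsGT (not_le.1 h1)] with t ht
      exact abs_le.2 ⟨by linarith [ht.1], by linarith [ht.2]⟩
    · right
      filter_upwards [Ioo_mem_nhdsGT (not_le.1 h2)] with t ht hle
      linarith [(abs_le.1 hle).1, ht.2]

lemma isPotential_pathPotential {x : ℕ → ℝ} (h0 : x 0 = 0) (n : ℕ) :
    IsPotential (pathPotential x n) := by
  have hpc : (∀ a b : ℝ, {y ∈ Icc a b | ¬ ContinuousAt (pathPotential x n) y}.Finite) ∧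
      (∀ y, ∃ l, Tendsto (pathPotential x n) (𝓝[<] y) (𝓝 l)) ∧
      ∀ y, ∃ l, Tendsto (pathPotential x n) (𝓝[>] y) (𝓝 l) := by
    have hpt : ∀ c y : ℝ, |y - c| ≤ 0 ↔ y = c := fun c y => by
      rw [abs_nonpos_iff, sub_eq_zero]
    induction n with
    | zero =>
      -- Changing the value at one point is the case of an interval of radius `0`.
      refine piecewiseContinuous_ite (f := fun _ => -1) ⟨fun a b => ?_, fun y => ?_, fun y => ?_⟩
        0 0 0 (fun y hy => ?_) (fun y hy => ?_)
      · simp [continuousAt_const]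
      · exact ⟨-1, tendsto_const_nhds⟩
      · exact ⟨-1, tendsto_const_nhds⟩
      · rw [hpt] at hy
        simp [pathPotential, initialPotential, hy]
      · rw [hpt] at hy
        simp [pathPotential, initialPotential, hy]
    | succ n ih =>
      classical
      refine piecewiseContinuous_ite (piecewiseContinuous_ite
        (g := fun y => if |y - x n| ≤ |x (n + 1) - x n| then (n : ℝ) else pathPotential x n y)
        ih (x n) |x (n + 1) - x n| n (fun y hy => if_pos hy) fun y hy => if_neg hy)
        (x (n + 1)) 0 (n + 1) (fun y hy => ?_) fun y hy => ?_
      · rw [hpt] at hy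
        simp [pathPotential, hy]
      · rw [hpt] at hy
        simp [pathPotential, hy]
  exact ⟨hpc.1, hpc.2.1, hpc.2.2, x n, (isMax_pathPotential_iff h0 n _).2 rfl,
    fun y hy => (isMax_pathPotential_iff h0 n y).1 hy⟩

lemma measurable_pathPotential (n : ℕ) :
    Measurable fun a : (ℕ → ℝ) × ℝ => pathPotential a.1 n a.2 := by
  induction n with
  | zero =>
    refine Measurable.sub (Measurable.ite ?_ measurable_const measurable_const) measurable_const
    exact measurable_snd (measurableSet_singleton 0)
  | succ n ih =>
    refine Measurable.ite ?_ measurable_const (Measurable.ite ?_ measurable_const ih)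
    · exact measurableSet_eq_fun (by fun_prop) (by fun_prop)
    · exact measurableSet_le (by fun_prop) (by fun_prop)

lemma isDepth_pathPotential {x : ℕ → ℝ} (h0 : x 0 = 0) (n : ℕ) :
    IsDepth (fun y => n - pathPotential x n y) (x n) (n + 1) where
  measurable := measurable_const.sub ((measurable_pathPotential n).comp measurable_prodMk_left)
  nonneg y := by
    by_cases hy : y = x n
    · rw [hy, pathPotential_self h0, sub_self]
    · linarith [pathPotential_le h0 n hy]
  le y := by linarith [neg_one_le_pathPotential x n y]
  one_le y hy := by linarith [pathPotential_le h0 n hy]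

lemma isRadius_pathPotential_iff {x : ℕ → ℝ} (h0 : x 0 = 0) (n : ℕ) (e z : ℝ) :
    IsRadius (pathPotential x n) e z ↔
      0 < z ∧ symmArea (fun y => n - pathPotential x n y) (x n) z = e := by
  rw [IsRadius, argMax_pathPotential h0, maxVal_pathPotential h0, symmArea]

lemma radius_pathPotential {x : ℕ → ℝ} (h0 : x 0 = 0) (n : ℕ) {e : ℝ} (he : 0 < e) :
    radius (pathPotential x n) e = halfWidth (fun y => n - pathPotential x n y) (x n) e := by
  rw [radius, halfWidth, if_pos he]
  congr 1
  ext z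
  exact isRadius_pathPotential_iff h0 n e z

lemma nextPoint_pathPotential {x : ℕ → ℝ} (h0 : x 0 = 0) (n : ℕ) {w : ℝ × ℝ} (hw : 0 < w.1) :
    nextPoint w (pathPotential x n) = nextPos (fun y => n - pathPotential x n y) (x n) w := by
  simp only [nextPoint, nextPos, radius_pathPotential h0 n hw, argMax_pathPotential h0,
    maxVal_pathPotential h0]

lemma abs_nextPos_sub {h : ℝ → ℝ} {s C : ℝ} (hh : IsDepth h s C) (w : ℝ × ℝ) :
    |nextPos h s w - s| = halfWidth h s w.1 := by
  have h0 := hh.halfWidth_nonneg w.1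
  rw [nextPos]
  split_ifs
  · rw [show s - halfWidth h s w.1 - s = -halfWidth h s w.1 by ring, abs_neg, abs_of_nonneg h0]
  · rw [show s + halfWidth h s w.1 - s = halfWidth h s w.1 by ring, abs_of_nonneg h0]

lemma stepOp_pathPotential {x : ℕ → ℝ} (h0 : x 0 = 0) (n : ℕ) {w : ℝ × ℝ} (hw : 0 < w.1)
    (hx : x (n + 1) = nextPos (fun y => n - pathPotential x n y) (x n) w) :
    stepOp w (pathPotential x n) = pathPotential x (n + 1) := by
  ext y
  have hr : |x (n + 1) - x n| = radius (pathPotential x n) w.1 := by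
    rw [hx, abs_nextPos_sub (isDepth_pathPotential h0 n), radius_pathPotential h0 n hw]
  have hmem : y ∈ Icc (x n - radius (pathPotential x n) w.1)
      (x n + radius (pathPotential x n) w.1) ↔ |y - x n| ≤ |x (n + 1) - x n| := by
    rw [hr, abs_le, mem_Icc]
    constructor <;> rintro ⟨h1, h2⟩ <;> constructor <;> linarith
  simp only [stepOp, pathPotential, nextPoint_pathPotential h0 n hw, ← hx,
    argMax_pathPotential h0, maxVal_pathPotential h0, hmem]

/-! ### The chain of maximum points -/

/-- The place that follows the history `0, x 0, …, x (n - 1)` for the pair `w`. -/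
def chainNext {n : ℕ} (x : Fin n → ℝ) (w : ℝ × ℝ) : ℝ :=
  nextPos (fun y => n - pathPotential (path x) n y) (path x n) w

/-- The first `n` places after the origin. -/
def chain (w : ℕ → ℝ × ℝ) : (n : ℕ) → Fin n → ℝ
  | 0 => Fin.elim0
  | n + 1 => Fin.snoc (α := fun _ => ℝ) (chain w n) (chainNext (chain w n) (w n))

lemma measurable_chainNext (n : ℕ) :
    Measurable fun a : (Fin n → ℝ) × (ℝ × ℝ) => chainNext a.1 a.2 := by
  refine measurable_nextPos (h := fun x : Fin n → ℝ => fun y => n - pathPotential (path x) n y)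
    (s := fun x => path x n) (C := fun _ => n + 1) (measurable_path n) ?_
    fun x => isDepth_pathPotential (path_zero x) n
  exact measurable_const.sub ((measurable_pathPotential n).comp
    ((measurable_path_pi.comp measurable_fst).prodMk measurable_snd))

lemma measurable_snoc (n : ℕ) :
    Measurable fun a : (Fin n → ℝ) × ℝ => (Fin.snoc a.1 a.2 : Fin (n + 1) → ℝ) := by
  refine measurable_pi_iff.2 fun i => ?_
  refine Fin.lastCases ?_ (fun j => ?_) i
  · simpa using measurable_snd
  · simp only [Fin.snoc_castSucc]
    exact (measurable_pi_apply j).comp measurable_fst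

lemma measurable_chain (n : ℕ) : Measurable fun w : ℕ → ℝ × ℝ => chain w n := by
  induction n with
  | zero => exact measurable_const
  | succ n ih =>
    exact (measurable_snoc n).comp
      (ih.prodMk ((measurable_chainNext n).comp (ih.prodMk (measurable_pi_apply n))))

lemma chain_congr {w w' : ℕ → ℝ × ℝ} {n : ℕ} (h : ∀ i < n, w i = w' i) :
    chain w n = chain w' n := by
  induction n with
  | zero => rfl
  | succ n ih =>
    rw [chain, chain, ih fun i hi => h i (hi.trans n.lt_succ_self), h n n.lt_succ_self]

lemma path_chain (w : ℕ → ℝ × ℝ) {i n : ℕ} (hi : i ≤ n) :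
    path (chain w n) i = path (chain w i) i := by
  induction n, hi using Nat.le_induction with
  | base => rfl
  | succ n hi ih => rw [chain, path_snoc _ _ hi, ih]

/-- A potential is determined by the successive maximum points. Positivity of the areas is needed
because `radius` and `halfWidth` are only compared there. -/
lemma potentialSeq_eq {w : ℕ → ℝ × ℝ} (hw : ∀ k, 0 < (w k).1) (n : ℕ) :
    potentialSeq w n = pathPotential (path (chain w n)) n := by
  induction n with
  | zero => rfl
  | succ n ih =>
    have hcongr : pathPotential (path (chain w n)) n = pathPotential (path (chain w (n + 1))) n :=
      pathPotential_congr fun i hi => (path_snoc _ _ hi).symm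
    rw [potentialSeq, ih, hcongr]
    refine stepOp_pathPotential (path_zero _) n (hw n) ?_
    rw [← hcongr, chain, path_snoc_last, path_snoc _ _ le_rfl, chainNext]

lemma argMax_potentialSeq {w : ℕ → ℝ × ℝ} (hw : ∀ k, 0 < (w k).1) {n : ℕ} (i : Fin n) :
    argMax (potentialSeq w (i + 1)) = chain w n i := by
  rw [potentialSeq_eq hw, argMax_pathPotential (path_zero _), ← path_chain w i.2, path_succ]

lemma potentialSeq_wellDefined {w : ℕ → ℝ × ℝ} (hw : ∀ k, 0 < (w k).1) (n : ℕ) :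
    IsPotential (potentialSeq w n) ∧ ∃! z, IsRadius (potentialSeq w n) (w n).1 z := by
  rw [potentialSeq_eq hw]
  refine ⟨isPotential_pathPotential (path_zero _) n, ?_⟩
  simp only [isRadius_pathPotential_iff (path_zero _)]
  exact (isDepth_pathPotential (path_zero _) n).existsUnique_symmArea_eq (hw n)

/-! ### The intensity of explored regions -/

lemma spaceTimeIntensity_eq_prod :
    spaceTimeIntensity = (volume : Measure ℝ).prod (volume.restrict (Ioi (-1))) := by
  rw [spaceTimeIntensity, Measure.volume_eq_prod, ← Measure.prod_restrict, Measure.restrict_univ]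

instance : SigmaFinite spaceTimeIntensity := by
  rw [spaceTimeIntensity]; infer_instance

/-- The probability that no customer arrives in `D`. -/
def voidProb (D : Set (ℝ × ℝ)) : ℝ≥0∞ :=
  ENNReal.ofReal (Real.exp (-(spaceTimeIntensity D).toReal))

lemma spaceTimeIntensity_explored_lt_top (r : ℝ) (n : ℕ) (x : ℕ → ℝ) :
    spaceTimeIntensity (explored r n x) < ∞ := by
  have hsub : explored r n x ⊆ ⋃ i ∈ Finset.range n,
      Icc (x i - (|x (i + 1) - x i| + r)) (x i + (|x (i + 1) - x i| + r)) ×ˢ Iic (i : ℝ) := by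
    rintro q ⟨i, hi, hq, ht⟩
    have := abs_le.1 hq
    exact mem_biUnion (Finset.mem_coe.2 (Finset.mem_range.2 hi))
      ⟨⟨by linarith, by linarith⟩, ht⟩
  refine (measure_mono hsub).trans_lt (measure_biUnion_lt_top (Finset.finite_toSet _) fun i _ => ?_)
  rw [spaceTimeIntensity_eq_prod, Measure.prod_prod, Measure.restrict_apply measurableSet_Iic,
    inter_comm, Ioi_inter_Iic, Real.volume_Icc, Real.volume_Ioc]
  exact ENNReal.mul_lt_top ENNReal.ofReal_lt_top ENNReal.ofReal_lt_top

/-- Searching an interval up to time `n` and raising the potential to `n` over it are the same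
operation; earlier layers there end no later. The point `x n` is excluded because its peak has not
been searched, and it carries no mass. -/
lemma mem_explored_iff {x : ℕ → ℝ} (h0 : x 0 = 0) {n : ℕ} {y t : ℝ} (hy : y ≠ x n) (ht : -1 < t) :
    (y, t) ∈ explored 0 n x ↔ t ≤ pathPotential x n y := by
  induction n with
  | zero =>
    rw [h0] at hy
    simp [explored, pathPotential, initialPotential, hy, ht]
  | succ n ih =>
    rw [explored_succ]
    simp only [mem_union, mem_ofPred_eq, add_zero, pathPotential, hy, if_false]
    split_ifs with h
    · simp only [h, true_and]
      constructor
      · rintro (⟨i, hi, -, hti⟩ | h)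
        · exact hti.trans (by exact_mod_cast hi.le)
        · exact h
      · exact Or.inr
    · have hy' : y ≠ x n := by rintro rfl; simp at h
      simp only [h, false_and, or_false, ih hy']

/-- Integration over the customers that arrived by time `n` and have not been explored. -/
lemma lintegral_unexplored {x : ℕ → ℝ} (h0 : x 0 = 0) (n : ℕ) {G : ℝ → ℝ≥0∞}
    (hG : Measurable G) :
    ∫⁻ q, {q : ℝ × ℝ | q.2 ≤ n ∧ q ∉ explored 0 n x}.indicator (fun q => G q.1) q
      ∂spaceTimeIntensity = ∫⁻ y, ENNReal.ofReal (n - pathPotential x n y) * G y := by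
  have hms : MeasurableSet {q : ℝ × ℝ | q.2 ≤ n ∧ q ∉ explored 0 n x} :=
    (measurableSet_le measurable_snd measurable_const).inter (measurableSet_explored 0 n x).compl
  have hm : Measurable ({q : ℝ × ℝ | q.2 ≤ n ∧ q ∉ explored 0 n x}.indicator fun q => G q.1) :=
    (hG.comp measurable_fst).indicator hms
  rw [spaceTimeIntensity_eq_prod, lintegral_prod _ hm.aemeasurable]
  refine lintegral_congr_ae ?_
  have hne : ∀ᵐ y : ℝ, y ≠ x n := by simp [ae_iff]
  filter_upwards [hne] with y hy
  have hin : ∀ t ∈ Ioi (-1 : ℝ),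
      {q : ℝ × ℝ | q.2 ≤ n ∧ q ∉ explored 0 n x}.indicator (fun q => G q.1) (y, t) =
        (Ioc (pathPotential x n y) n).indicator (fun _ => G y) t := by
    intro t ht
    have hiff : (y, t) ∈ {q : ℝ × ℝ | q.2 ≤ n ∧ q ∉ explored 0 n x} ↔
        t ∈ Ioc (pathPotential x n y) n := by
      rw [mem_ofPred_eq, mem_explored_iff h0 hy ht, not_le, mem_Ioc, and_comm]
    by_cases h : t ∈ Ioc (pathPotential x n y) n
    · rw [indicator_of_mem h, indicator_of_mem (hiff.2 h)]
    · rw [indicator_of_notMem h, indicator_of_notMem (mt hiff.1 h)]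
  rw [setLIntegral_congr_fun measurableSet_Ioi hin, lintegral_indicator_const measurableSet_Ioc,
    Measure.restrict_apply measurableSet_Ioc, inter_eq_left.2, Real.volume_Ioc, mul_comm]
  -- The potential never drops below `-1`, so the restriction to times after `-1` removes nothing.
  exact fun t ht => (neg_one_le_pathPotential x n y).trans_lt ht.1

/-- The part of the new layer not explored before lies between the potential and its maximum, so its
intensity is an area under the depth. -/
lemma spaceTimeIntensity_explored_succ {x : ℕ → ℝ} (h0 : x 0 = 0) (n : ℕ) :
    spaceTimeIntensity (explored 0 (n + 1) x) = spaceTimeIntensity (explored 0 n x) +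
      ENNReal.ofReal (symmArea (fun y => n - pathPotential x n y) (x n) |x (n + 1) - x n|) := by
  have hd := isDepth_pathPotential h0 n
  set r := |x (n + 1) - x n| with hr
  have hr0 : 0 ≤ r := abs_nonneg _
  set A : Set (ℝ × ℝ) := {q | q.2 ≤ n ∧ q ∉ explored 0 n x} with hA
  have hms : MeasurableSet A :=
    (measurableSet_le measurable_snd measurable_const).inter (measurableSet_explored 0 n x).compl
  have hB : MeasurableSet (Prod.fst ⁻¹' Icc (x n - r) (x n + r) : Set (ℝ × ℝ)) :=
    measurable_fst measurableSet_Icc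
  have hset : explored 0 (n + 1) x =
      explored 0 n x ∪ A ∩ Prod.fst ⁻¹' Icc (x n - r) (x n + r) := by
    rw [explored_succ]
    ext q
    have : |q.1 - x n| ≤ r ↔ q.1 ∈ Icc (x n - r) (x n + r) := by
      rw [abs_le, mem_Icc]; constructor <;> rintro ⟨h1, h2⟩ <;> constructor <;> linarith
    simp only [mem_union, mem_ofPred_eq, add_zero, mem_inter_iff, mem_preimage, hA]
    tauto
  rw [hset, measure_union (disjoint_left.2 fun q h1 h2 => h2.1.2 h1) (hms.inter hB)]
  congr 1
  have hind : ∀ q, (A ∩ Prod.fst ⁻¹' Icc (x n - r) (x n + r)).indicator (1 : ℝ × ℝ → ℝ≥0∞) q =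
      A.indicator (fun q => (Icc (x n - r) (x n + r)).indicator (1 : ℝ → ℝ≥0∞) q.1) q := by
    intro q
    rw [← indicator_indicator]
    rfl
  rw [← lintegral_indicator_one (hms.inter hB), lintegral_congr hind,
    lintegral_unexplored h0 n (measurable_one.indicator measurableSet_Icc)]
  have hind' : ∀ y, ENNReal.ofReal (n - pathPotential x n y) *
      (Icc (x n - r) (x n + r)).indicator (1 : ℝ → ℝ≥0∞) y =
      (Icc (x n - r) (x n + r)).indicator (fun y => ENNReal.ofReal (n - pathPotential x n y)) y := by
    intro y
    simp only [indicator, Pi.one_apply]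
    split_ifs <;> simp
  have hle : x n - r ≤ x n + r := by linarith
  rw [lintegral_congr hind', lintegral_indicator measurableSet_Icc,
    setLIntegral_congr Ioc_ae_eq_Icc.symm, ← ofReal_integral_eq_lintegral_ofReal
    ((intervalIntegrable_iff_integrableOn_Ioc_of_le hle).1 (hd.intervalIntegrable _ _))
    (Eventually.of_forall hd.nonneg), ← intervalIntegral.integral_of_le hle, symmArea]

/-- The new factor is the exponential in the density of the next maximum point; this is where the
two models meet. -/
lemma voidProb_explored_succ {x : ℕ → ℝ} (h0 : x 0 = 0) (n : ℕ) :
    voidProb (explored 0 (n + 1) x) = voidProb (explored 0 n x) * ENNReal.ofReal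
      (Real.exp (-symmArea (fun y => n - pathPotential x n y) (x n) |x (n + 1) - x n|)) := by
  rw [voidProb, voidProb, spaceTimeIntensity_explored_succ h0, ENNReal.toReal_add
    (spaceTimeIntensity_explored_lt_top 0 n x).ne ENNReal.ofReal_ne_top, ENNReal.toReal_ofReal
    ((isDepth_pathPotential h0 n).symmArea_nonneg (abs_nonneg _)), neg_add, Real.exp_add,
    ENNReal.ofReal_mul (Real.exp_nonneg _)]

/-! ### The density of the first customers served -/

/-- The places of the customers `p`. -/
def places {n : ℕ} (p : Fin n → ℝ × ℝ) : Fin n → ℝ := fun i => (p i).1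

/-- The density of the first `n` customers served with respect to the intensity. -/
def servedDensity {n : ℕ} (p : Fin n → ℝ × ℝ) : ℝ≥0∞ :=
  {p : Fin n → ℝ × ℝ | IsAdmissible p}.indicator
    (fun p => voidProb (explored 0 n (path (places p)))) p

lemma servedDensity_of_isAdmissible {n : ℕ} {p : Fin n → ℝ × ℝ} (hp : IsAdmissible p) :
    servedDensity p = voidProb (explored 0 n (path (places p))) :=
  indicator_of_mem (s := {p : Fin n → ℝ × ℝ | IsAdmissible p}) hp _

lemma servedDensity_of_not_isAdmissible {n : ℕ} {p : Fin n → ℝ × ℝ} (hp : ¬ IsAdmissible p) :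
    servedDensity p = 0 :=
  indicator_of_notMem (s := {p : Fin n → ℝ × ℝ | IsAdmissible p}) hp _

lemma measurable_places (n : ℕ) : Measurable (places (n := n)) :=
  measurable_pi_iff.2 fun i => (measurable_pi_apply i).fst

lemma measurableSet_isAdmissible (n : ℕ) : MeasurableSet {p : Fin n → ℝ × ℝ | IsAdmissible p} := by
  have : {p : Fin n → ℝ × ℝ | IsAdmissible p} = ⋂ i : Fin n,
      {p | (p i).2 ≤ ((i : ℕ) : ℝ)} ∩ {p | (path (places p), p i) ∈
        {a : (ℕ → ℝ) × (ℝ × ℝ) | a.2 ∈ explored 0 i a.1}}ᶜ := by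
    ext p; simp only [mem_iInter]; rfl
  rw [this]
  refine MeasurableSet.iInter fun i => ?_
  have hp : Measurable fun p : Fin n → ℝ × ℝ => (path (places p), p i) :=
    (measurable_path_pi.comp (measurable_places n)).prodMk (measurable_pi_apply i)
  exact (measurableSet_le (measurable_pi_apply i).snd measurable_const).inter
    (hp (measurableSet_explored_prod 0 i)).compl

lemma measurable_servedDensity (n : ℕ) : Measurable (servedDensity (n := n)) := by
  refine Measurable.indicator ?_ (measurableSet_isAdmissible n)
  have h1 : Measurable fun x : ℕ → ℝ => spaceTimeIntensity (explored 0 n x) :=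
    measurable_measure_prodMk_left (measurableSet_explored_prod 0 n)
  have h2 := h1.comp (measurable_path_pi.comp (measurable_places n))
  exact (Real.measurable_exp.comp h2.ennreal_toReal.neg).ennreal_ofReal

lemma places_snoc {n : ℕ} (p : Fin n → ℝ × ℝ) (q : ℝ × ℝ) :
    places (Fin.snoc p q : Fin (n + 1) → ℝ × ℝ) = Fin.snoc (places p) q.1 := by
  ext i
  refine Fin.lastCases ?_ (fun j => ?_) i <;> simp [places]

lemma isAdmissible_snoc {n : ℕ} (p : Fin n → ℝ × ℝ) (q : ℝ × ℝ) :
    IsAdmissible (Fin.snoc p q : Fin (n + 1) → ℝ × ℝ) ↔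
      IsAdmissible p ∧ q.2 ≤ n ∧ q ∉ explored 0 n (path (places p)) := by
  have hex : ∀ i ≤ n, explored 0 i (path fun j => ((Fin.snoc p q : Fin (n + 1) → ℝ × ℝ) j).1) =
      explored 0 i (path (places p)) := by
    intro i hi
    change explored 0 i (path (places (Fin.snoc p q : Fin (n + 1) → ℝ × ℝ))) = _
    rw [places_snoc]
    exact explored_congr fun k hk => path_snoc _ _ (hk.trans hi)
  rw [IsAdmissible, Fin.forall_fin_succ', Fin.snoc_last, Fin.val_last, hex n le_rfl]
  refine and_congr_left fun _ => forall_congr' fun i => ?_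
  rw [Fin.snoc_castSucc, Fin.val_castSucc, hex i i.2.le]
  rfl

lemma servedDensity_snoc {n : ℕ} (p : Fin n → ℝ × ℝ) (q : ℝ × ℝ) :
    servedDensity (Fin.snoc p q : Fin (n + 1) → ℝ × ℝ) = servedDensity p *
      {q : ℝ × ℝ | q.2 ≤ n ∧ q ∉ explored 0 n (path (places p))}.indicator
        (fun q => ENNReal.ofReal (Real.exp (-symmArea
          (fun y => n - pathPotential (path (places p)) n y) (path (places p) n)
            |q.1 - path (places p) n|))) q := by
  have hpot : pathPotential (path (places (Fin.snoc p q : Fin (n + 1) → ℝ × ℝ))) n =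
      pathPotential (path (places p)) n := by
    rw [places_snoc]; exact pathPotential_congr fun i hi => path_snoc _ _ hi
  have hexp : explored 0 n (path (places (Fin.snoc p q : Fin (n + 1) → ℝ × ℝ))) =
      explored 0 n (path (places p)) := by
    rw [places_snoc]; exact explored_congr fun i hi => path_snoc _ _ hi
  set A : Set (ℝ × ℝ) := {q : ℝ × ℝ | q.2 ≤ n ∧ q ∉ explored 0 n (path (places p))} with hA
  by_cases h1 : IsAdmissible p
  · by_cases h2 : q ∈ A
    · rw [servedDensity_of_isAdmissible ((isAdmissible_snoc p q).2 ⟨h1, h2⟩),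
        servedDensity_of_isAdmissible h1, indicator_of_mem h2,
        voidProb_explored_succ (path_zero _), hpot, hexp, places_snoc, path_snoc_last,
        path_snoc _ _ le_rfl]
    · rw [servedDensity_of_not_isAdmissible fun h => h2 ((isAdmissible_snoc p q).1 h).2,
        indicator_of_notMem h2, mul_zero]
  · rw [servedDensity_of_not_isAdmissible fun h => h1 ((isAdmissible_snoc p q).1 h).1,
      servedDensity_of_not_isAdmissible h1, zero_mul]

lemma lintegral_pi_snoc {n : ℕ} {F : (Fin (n + 1) → ℝ × ℝ) → ℝ≥0∞} (hF : Measurable F) :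
    ∫⁻ p, F p ∂(Measure.pi fun _ => spaceTimeIntensity) =
      ∫⁻ p : Fin n → ℝ × ℝ, ∫⁻ q, F (Fin.snoc p q) ∂spaceTimeIntensity
        ∂(Measure.pi fun _ => spaceTimeIntensity) := by
  have hmp := (measurePreserving_piFinSuccAbove (fun _ : Fin (n + 1) => spaceTimeIntensity)
    (Fin.last n)).symm
  rw [← hmp.lintegral_comp hF, lintegral_prod_symm' (fun a => F
    ((MeasurableEquiv.piFinSuccAbove (fun _ => ℝ × ℝ) (Fin.last n)).symm a))
    (hF.comp hmp.measurable)]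
  refine lintegral_congr fun p => lintegral_congr fun q => ?_
  congr 1
  exact Fin.insertNth_last' q p

/-- The law of the chain of maximum points is the image of the density of the customers. -/
lemma lintegral_chain {Ω' : Type*} [MeasurableSpace Ω'] {Q : Measure Ω'} [IsProbabilityMeasure Q]
    {W : Ω' → ℕ → ℝ × ℝ} (hW : Measurable W)
    (hlaw : ∀ n, Q.map (fun ω => (chain (W ω) n, W ω n)) =
      (Q.map fun ω => chain (W ω) n).prod ((expMeasure 1).prod (volume.restrict (Icc (0 : ℝ) 1))))
    (n : ℕ) {g : (Fin n → ℝ) → ℝ≥0∞} (hg : Measurable g) :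
    ∫⁻ ω, g (chain (W ω) n) ∂Q =
      ∫⁻ p, servedDensity p * g (places p) ∂(Measure.pi fun _ => spaceTimeIntensity) := by
  have : IsProbabilityMeasure (expMeasure 1) := isProbabilityMeasure_expMeasure one_pos
  induction n with
  | zero =>
    have hadm : ∀ p : Fin 0 → ℝ × ℝ, servedDensity p = 1 := fun p => by
      rw [servedDensity_of_isAdmissible fun i => i.elim0]
      simp [voidProb, explored]
    have hgc : ∀ x, g x = g Fin.elim0 := fun x => by rw [Subsingleton.elim x]
    simp_rw [hadm, hgc (places _), chain]
    simp
  | succ n ih =>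
    have hWn : Measurable fun ω => chain (W ω) n := (measurable_chain n).comp hW
    have hWp : Measurable fun ω => (chain (W ω) n, W ω n) :=
      hWn.prodMk ((measurable_pi_apply n).comp hW)
    have hF : Measurable fun a : (Fin n → ℝ) × (ℝ × ℝ) =>
        g (Fin.snoc (α := fun _ => ℝ) a.1 (chainNext a.1 a.2)) :=
      hg.comp ((measurable_snoc n).comp (measurable_fst.prodMk (measurable_chainNext n)))
    have hsn : ∀ x : Fin n → ℝ, Measurable fun y => g (Fin.snoc (α := fun _ => ℝ) x y) := fun x =>
      hg.comp ((measurable_snoc n).comp measurable_prodMk_left)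
    -- The pair used at this step is independent of the history, so it can be averaged out first.
    have e1 : ∫⁻ ω, g (chain (W ω) (n + 1)) ∂Q = ∫⁻ ω, (∫⁻ w,
        g (Fin.snoc (α := fun _ => ℝ) (chain (W ω) n) (chainNext (chain (W ω) n) w))
          ∂((expMeasure 1).prod (volume.restrict (Icc (0 : ℝ) 1)))) ∂Q := by
      rw [← lintegral_map (f := fun x => ∫⁻ w, g (Fin.snoc (α := fun _ => ℝ) x (chainNext x w))
        ∂((expMeasure 1).prod (volume.restrict (Icc (0 : ℝ) 1)))) hF.lintegral_prod_right' hWn,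
        ← lintegral_prod _ hF.aemeasurable, ← hlaw n, lintegral_map hF hWp]
      rfl
    have hFs : Measurable fun p : Fin (n + 1) → ℝ × ℝ => servedDensity p * g (places p) :=
      (measurable_servedDensity _).mul (hg.comp (measurable_places _))
    rw [e1, ih hF.lintegral_prod_right', lintegral_pi_snoc hFs]
    refine lintegral_congr fun p => ?_
    set x := path (places p) with hx
    have h0 : x 0 = 0 := path_zero _
    have hd := isDepth_pathPotential h0 n
    have hem : Measurable fun y => ENNReal.ofReal (Real.exp
        (-symmArea (fun y => n - pathPotential x n y) (x n) |y - x n|)) :=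
      (Real.measurable_exp.comp (hd.continuous_symmArea.measurable.comp
        (by fun_prop : Measurable fun y : ℝ => |y - x n|)).neg).ennreal_ofReal
    have hprod : ∀ q, servedDensity (Fin.snoc p q : Fin (n + 1) → ℝ × ℝ) *
        g (places (Fin.snoc p q : Fin (n + 1) → ℝ × ℝ)) = servedDensity p *
        {q : ℝ × ℝ | q.2 ≤ n ∧ q ∉ explored 0 n x}.indicator (fun q => ENNReal.ofReal (Real.exp
          (-symmArea (fun y => n - pathPotential x n y) (x n) |q.1 - x n|)) *
          g (Fin.snoc (α := fun _ => ℝ) (places p) q.1)) q := by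
      intro q
      rw [servedDensity_snoc, places_snoc, mul_assoc, indicator_mul_left]
    have hm2 : Measurable fun y => ENNReal.ofReal (Real.exp
        (-symmArea (fun y => n - pathPotential x n y) (x n) |y - x n|)) *
          g (Fin.snoc (α := fun _ => ℝ) (places p) y) := hem.mul (hsn (places p))
    have hm3 : Measurable fun q : ℝ × ℝ => ENNReal.ofReal (Real.exp
        (-symmArea (fun y => n - pathPotential x n y) (x n) |q.1 - x n|)) *
          g (Fin.snoc (α := fun _ => ℝ) (places p) q.1) := hm2.comp measurable_fst
    have hms : MeasurableSet {q : ℝ × ℝ | q.2 ≤ n ∧ q ∉ explored 0 n x} :=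
      (measurableSet_le measurable_snd measurable_const).inter (measurableSet_explored 0 n x).compl
    rw [lintegral_congr hprod, lintegral_const_mul _ (hm3.indicator hms)]
    congr 1
    -- Averaging over the pair `w` and integrating over unexplored customers both give the
    -- depth-weighted integral over the next place.
    exact (hd.lintegral_nextPos (hsn _)).trans (lintegral_unexplored h0 n hm2).symm

/-! ### Cells of small width and unit duration -/

/-- The width of the cells of level `k`. -/
def mesh (k : ℕ) : ℝ := 1 / ((k : ℝ) + 1)

lemma mesh_pos (k : ℕ) : 0 < mesh k := Nat.one_div_pos_of_nat

lemma tendsto_mesh : Tendsto mesh atTop (𝓝 0) := tendsto_one_div_add_atTop_nhds_zero_nat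

/-- The index of the cell of level `k` that contains a given point. -/
def cellOf (k : ℕ) (q : ℝ × ℝ) : ℤ × ℤ := (⌊((k : ℝ) + 1) * q.1⌋, ⌈q.2⌉)

/-- The upper left corner of a cell. -/
def corner (k : ℕ) (c : ℤ × ℤ) : ℝ × ℝ := (c.1 / ((k : ℝ) + 1), c.2)

/-- The cell of level `k` with index `c`. -/
def cell (k : ℕ) (c : ℤ × ℤ) : Set (ℝ × ℝ) := cellOf k ⁻¹' {c}

lemma measurable_cellOf (k : ℕ) : Measurable (cellOf k) :=
  (Int.measurable_floor.comp (by fun_prop)).prodMk (Int.measurable_ceil.comp measurable_snd)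

lemma measurableSet_cell (k : ℕ) (c : ℤ × ℤ) : MeasurableSet (cell k c) :=
  measurable_cellOf k (measurableSet_singleton c)

lemma cell_eq (k : ℕ) (c : ℤ × ℤ) :
    cell k c = Ico ((corner k c).1) ((corner k c).1 + mesh k) ×ˢ Ioc ((c.2 : ℝ) - 1) c.2 := by
  ext q
  have hk : (0 : ℝ) < (k : ℝ) + 1 := by positivity
  simp only [cell, cellOf, mem_preimage, mem_singleton_iff, Prod.ext_iff, Int.floor_eq_iff,
    Int.ceil_eq_iff, mem_prod, mem_Ico, mem_Ioc, corner, mesh, ← add_div, div_le_iff₀ hk,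
    lt_div_iff₀ hk, mul_comm q.1]

lemma abs_sub_corner_le (k : ℕ) (q : ℝ × ℝ) : |q.1 - (corner k (cellOf k q)).1| ≤ mesh k := by
  have h : q ∈ cell k (cellOf k q) := rfl
  rw [cell_eq] at h
  rw [abs_le]
  constructor <;> linarith [h.1.1, h.1.2, mesh_pos k]

lemma spaceTimeIntensity_cell_le (k : ℕ) (c : ℤ × ℤ) :
    spaceTimeIntensity (cell k c) ≤ ENNReal.ofReal (mesh k) := by
  rw [cell_eq, spaceTimeIntensity]
  refine (Measure.restrict_apply_le _ _).trans ?_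
  rw [Measure.volume_eq_prod, Measure.prod_prod, Real.volume_Ico, Real.volume_Ioc]
  simp

/-- The places of the corners of a tuple of cells. -/
def cornerPlaces {n : ℕ} (k : ℕ) (c : Fin n → ℤ × ℤ) : Fin n → ℝ := fun i => (corner k (c i)).1

/-- Every choice of points in the cells `c` is admissible, with some room. -/
def IsCellAdmissible {n : ℕ} (k : ℕ) (c : Fin n → ℤ × ℤ) : Prop :=
  ∀ i : Fin n, ((c i).2 : ℝ) ≤ (i : ℕ) ∧
    corner k (c i) ∉ explored (4 * mesh k) i (path (cornerPlaces k c))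

lemma abs_path_places_sub_le {n k : ℕ} {p : Fin n → ℝ × ℝ} {c : Fin n → ℤ × ℤ}
    (hp : ∀ i, cellOf k (p i) = c i) (i : ℕ) :
    |path (places p) i - path (cornerPlaces k c) i| ≤ mesh k := by
  refine abs_path_sub_le (mesh_pos k).le (fun i => ?_) i
  rw [cornerPlaces, ← hp i]
  exact abs_sub_corner_le k (p i)

/-- The corner of a repeated cell would lie in the layer explored when the cell was first reached.
-/
lemma IsCellAdmissible.injective {n k : ℕ} {c : Fin n → ℤ × ℤ} (hc : IsCellAdmissible k c) :
    Function.Injective c := by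
  have key : ∀ i j : Fin n, i < j → c i ≠ c j := by
    intro i j hij h
    refine (hc j).2 ⟨i, hij, ?_, ?_⟩
    · rw [path_succ, cornerPlaces, h]
      linarith [mesh_pos k]
    · rw [← h]; exact (hc i).1
  intro i j h
  rcases lt_trichotomy i j with hij | hij | hij
  · exact absurd h (key i j hij)
  · exact hij
  · exact absurd h.symm (key j i hij)

lemma IsCellAdmissible.isAdmissible {n k : ℕ} {c : Fin n → ℤ × ℤ} (hc : IsCellAdmissible k c)
    {p : Fin n → ℝ × ℝ} (hp : ∀ i, cellOf k (p i) = c i) : IsAdmissible p := by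
  intro i
  have hpi : (c i).2 = ⌈(p i).2⌉ := by rw [← hp i]; rfl
  have hle : (p i).2 ≤ (c i).2 := by rw [hpi]; exact Int.le_ceil _
  refine ⟨hle.trans (hc i).1, fun hmem => (hc i).2 ?_⟩
  -- Replacing the path by corners costs `3 * mesh k` and replacing `p i` by its corner one more,
  -- whence the room `4 * mesh k`.
  obtain ⟨j, hj, hd, ht⟩ := explored_subset (abs_path_places_sub_le hp) hmem
  refine ⟨j, hj, ?_, ?_⟩
  · have h1 : |(corner k (c i)).1 - (p i).1| ≤ mesh k := by
      rw [abs_sub_comm, ← hp i]; exact abs_sub_corner_le k (p i)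
    have h2 := abs_sub_le (corner k (c i)).1 (p i).1 (path (cornerPlaces k c) j)
    linarith
  -- Choices are made at integer times, so rounding an arrival time up loses nothing; this is why
  -- cells of unit duration suffice.
  · have : (c i).2 ≤ (j : ℤ) := by rw [hpi, Int.ceil_le]; exact_mod_cast ht
    change ((c i).2 : ℝ) ≤ j
    exact_mod_cast this

/-! ### Events on which the first customers lie in given cells -/

/-- Each of the cells `c` contains one customer, and there are no other customers in the region
explored when these are served. -/
def cellEvent {Ω : Type*} (ν : Ω → Set (ℝ × ℝ)) {n : ℕ} (k : ℕ) (c : Fin n → ℤ × ℤ) : Set Ω :=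
  {ω | (∀ i, (ν ω ∩ cell k (c i)).encard = 1) ∧
    (ν ω ∩ (explored (3 * mesh k) n (path (cornerPlaces k c)) \ ⋃ i, cell k (c i))).encard = 0}

/-- The customers `p` are those that the server serves at the times `0, …, n - 1`. -/
def IsServed (ν : Set (ℝ × ℝ)) {n : ℕ} (p : Fin n → ℝ × ℝ) : Prop :=
  (∀ i, p i ∈ ν) ∧ IsAdmissible p ∧ ν ∩ explored 0 n (path (places p)) ⊆ range p

lemma IsServed.isNearest_iff {ν : Set (ℝ × ℝ)} {n : ℕ} {p : Fin n → ℝ × ℝ} (hp : IsServed ν p)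
    (i : Fin n) (q : ℝ × ℝ) :
    IsNearest ν (serverState ν i).2 (i : ℕ) (serverState ν i).1 q ↔ q = p i :=
  (isNearest_iff_of_isAdmissible hp.1 hp.2.1 hp.2.2 i i.2.le).2 i.2 q

lemma IsServed.chosen_eq {ν : Set (ℝ × ℝ)} {n : ℕ} {p : Fin n → ℝ × ℝ} (hp : IsServed ν p)
    (i : Fin n) : chosen ν i = p i := by
  rw [← hp.isNearest_iff]
  exact Classical.epsilon_spec ⟨_, (hp.isNearest_iff i _).2 rfl⟩

/-- The places of the first `n` customers served. -/
def serverPlaces (ν : Set (ℝ × ℝ)) (n : ℕ) : Fin n → ℝ := fun i => (serverState ν (i + 1)).1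

lemma IsServed.serverPlaces_eq {ν : Set (ℝ × ℝ)} {n : ℕ} {p : Fin n → ℝ × ℝ}
    (hp : IsServed ν p) : serverPlaces ν n = places p := by
  ext i
  rw [serverPlaces, serverState_succ, hp.chosen_eq]
  rfl

/-- The region explored along the actual customers is contained in the region enlarged by `3 * mesh
k` around the corners, and there the event leaves no customers outside the cells. -/
lemma exists_isServed {Ω : Type*} {ν : Ω → Set (ℝ × ℝ)} {n k : ℕ} {c : Fin n → ℤ × ℤ}
    (hc : IsCellAdmissible k c) {ω : Ω} (hω : ω ∈ cellEvent ν k c) :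
    ∃ p : Fin n → ℝ × ℝ, IsServed (ν ω) p ∧ ∀ i, cellOf k (p i) = c i := by
  choose p hp using fun i => encard_eq_one.1 (hω.1 i)
  have hpm : ∀ i, p i ∈ ν ω ∩ cell k (c i) := fun i => by rw [hp i]; exact mem_singleton _
  refine ⟨p, ⟨fun i => (hpm i).1, hc.isAdmissible fun i => (hpm i).2, ?_⟩, fun i => (hpm i).2⟩
  rintro q ⟨hqν, hq⟩
  have hq' := explored_subset (abs_path_places_sub_le fun i => (hpm i).2) hq
  rw [zero_add] at hq'
  by_contra hqp
  have h0 := encard_eq_zero.1 hω.2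
  refine eq_empty_iff_forall_notMem.1 h0 q ⟨hqν, hq', fun hqc => ?_⟩
  obtain ⟨i, hi⟩ := mem_iUnion.1 hqc
  have : q ∈ ν ω ∩ cell k (c i) := ⟨hqν, hi⟩
  rw [hp i] at this
  exact hqp ⟨i, this.symm⟩

/-- The configuration determines who is served, hence the cells. So distinct admissible tuples give
disjoint events, whose probabilities add up. -/
lemma cellEvent_eq_of_mem {Ω : Type*} {ν : Ω → Set (ℝ × ℝ)} {n k : ℕ} {c c' : Fin n → ℤ × ℤ}
    (hc : IsCellAdmissible k c) (hc' : IsCellAdmissible k c') {ω : Ω}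
    (hω : ω ∈ cellEvent ν k c) (hω' : ω ∈ cellEvent ν k c') : c = c' := by
  obtain ⟨p, hp, hpc⟩ := exists_isServed hc hω
  obtain ⟨p', hp', hpc'⟩ := exists_isServed hc' hω'
  ext1 i
  rw [← hpc, ← hpc', ← hp.chosen_eq, ← hp'.chosen_eq]

/-! ### Poisson probabilities of the cell events -/

section Poisson

variable {Ω : Type*} [MeasurableSpace Ω] {P : Measure Ω} {ν : Ω → Set (ℝ × ℝ)}

lemma IsPoissonProcess.measure_forall_encard_eq {X : Type*} [MeasurableSpace X] {ξ : Ω → Set X}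
    {Λ : Measure X} (hξ : IsPoissonProcess ξ Λ P) {m : ℕ} {A : Fin m → Set X}
    (hA : ∀ i, MeasurableSet (A i)) (hd : Pairwise fun i j => Disjoint (A i) (A j))
    (hfin : ∀ i, Λ (A i) ≠ ∞) (l : Fin m → ℕ) :
    P {ω | ∀ i, (ξ ω ∩ A i).encard = l i} =
      ∏ i, poissonMeasure (Λ (A i)).toNNReal {l i} := by
  have h := (hξ.indep_count m A hA hd).measure_inter_preimage_eq_mul Finset.univ
    (sets := fun i => {(l i : ℕ∞)}) fun i _ => measurableSet_singleton _
  have hset : {ω | ∀ i, (ξ ω ∩ A i).encard = l i} =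
      ⋂ i ∈ Finset.univ, (fun ω => (ξ ω ∩ A i).encard) ⁻¹' {(l i : ℕ∞)} := by
    ext ω
    simp only [mem_iInter, Finset.mem_univ, forall_true_left]
    rfl
  rw [hset, h]
  exact Finset.prod_congr rfl fun i _ => hξ.law_count (A i) (hA i) (hfin i) (l i)

lemma measurableSet_cellEvent (hν : IsPoissonProcess ν spaceTimeIntensity P) {n : ℕ} (k : ℕ)
    (c : Fin n → ℤ × ℤ) : MeasurableSet (cellEvent ν k c) := by
  have h1 : ∀ i, MeasurableSet {ω | (ν ω ∩ cell k (c i)).encard = 1} := fun i =>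
    hν.measurable_count _ (measurableSet_cell k (c i)) (measurableSet_singleton 1)
  have h2 := hν.measurable_count _ ((measurableSet_explored (3 * mesh k) n
    (path (cornerPlaces k c))).diff (MeasurableSet.iUnion fun i => measurableSet_cell k (c i)))
      (measurableSet_singleton 0)
  have : cellEvent ν k c = (⋂ i, {ω | (ν ω ∩ cell k (c i)).encard = 1}) ∩ {ω | (ν ω ∩
      (explored (3 * mesh k) n (path (cornerPlaces k c)) \ ⋃ i, cell k (c i))).encard = 0} := by
    ext ω; simp only [mem_inter_iff, mem_iInter]; rfl
  rw [this]
  exact (MeasurableSet.iInter h1).inter h2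

lemma voidProb_anti {D D' : Set (ℝ × ℝ)} (h : D ⊆ D') (hD' : spaceTimeIntensity D' ≠ ∞) :
    voidProb D' ≤ voidProb D :=
  ENNReal.ofReal_le_ofReal (Real.exp_le_exp.2
    (neg_le_neg (ENNReal.toReal_mono hD' (measure_mono h))))

/-- A cell of intensity `r ≤ mesh k` holds exactly one customer with probability `r * exp (-r)`, at
least `r * exp (-mesh k)`. Removing the cells from the region to be kept empty only raises its void
probability. -/
lemma le_measure_cellEvent (hν : IsPoissonProcess ν spaceTimeIntensity P) {n k : ℕ}
    {c : Fin n → ℤ × ℤ} (hc : IsCellAdmissible k c) :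
    (∏ i, spaceTimeIntensity (cell k (c i))) * (ENNReal.ofReal (Real.exp (-mesh k)) ^ n *
      voidProb (explored (3 * mesh k) n (path (cornerPlaces k c)))) ≤ P (cellEvent ν k c) := by
  set D := explored (3 * mesh k) n (path (cornerPlaces k c)) with hD
  have hDfin : spaceTimeIntensity D ≠ ∞ := (spaceTimeIntensity_explored_lt_top _ n _).ne
  -- The cells and the remaining region form one disjoint family, with prescribed counts `1, …, 1,
  -- 0`.
  set A : Fin (n + 1) → Set (ℝ × ℝ) :=
    Fin.snoc (α := fun _ => Set (ℝ × ℝ)) (fun i => cell k (c i)) (D \ ⋃ i, cell k (c i)) with hA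
  set l : Fin (n + 1) → ℕ := Fin.snoc (α := fun _ => ℕ) (fun _ => 1) 0 with hl
  have hAc : ∀ i : Fin n, A i.castSucc = cell k (c i) := fun i => by rw [hA, Fin.snoc_castSucc]
  have hAl : A (Fin.last n) = D \ ⋃ i, cell k (c i) := by rw [hA, Fin.snoc_last]
  have hlc : ∀ i : Fin n, l i.castSucc = 1 := fun i => by rw [hl, Fin.snoc_castSucc]
  have hll : l (Fin.last n) = 0 := by rw [hl, Fin.snoc_last]
  have hAm : ∀ i, MeasurableSet (A i) := by
    refine Fin.lastCases ?_ fun i => ?_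
    · rw [hAl]
      exact (measurableSet_explored _ _ _).diff (MeasurableSet.iUnion fun i => measurableSet_cell _ _)
    · rw [hAc]; exact measurableSet_cell _ _
  have hfc : ∀ i, spaceTimeIntensity (cell k (c i)) ≠ ∞ := fun i =>
    ((spaceTimeIntensity_cell_le k (c i)).trans_lt ENNReal.ofReal_lt_top).ne
  have hAf : ∀ i, spaceTimeIntensity (A i) ≠ ∞ := by
    refine Fin.lastCases ?_ fun i => ?_
    · rw [hAl]; exact measure_ne_top_of_subset sdiff_subset hDfin
    · rw [hAc]; exact hfc i
  have hdl : ∀ i : Fin n, Disjoint (A i.castSucc) (A (Fin.last n)) := fun i => by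
    rw [hAc, hAl]
    exact disjoint_sdiff_right.mono_left (subset_iUnion (fun i => cell k (c i)) i)
  have hAd : Pairwise fun i j => Disjoint (A i) (A j) := by
    intro i j
    refine Fin.lastCases (fun hij => ?_) (fun i hij => ?_) i
    · obtain ⟨j, rfl⟩ | rfl := j.eq_castSucc_or_eq_last
      · exact (hdl j).symm
      · exact absurd rfl hij
    · obtain ⟨j, rfl⟩ | rfl := j.eq_castSucc_or_eq_last
      · rw [hAc, hAc]
        refine disjoint_left.2 fun q hq hq' => hij ?_
        rw [hc.injective ((mem_singleton_iff.1 hq).symm.trans (mem_singleton_iff.1 hq'))]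
      · exact hdl i
  have hset : cellEvent ν k c = {ω | ∀ i, (ν ω ∩ A i).encard = l i} := by
    ext ω
    simp only [mem_ofPred_eq, Fin.forall_fin_succ', hAc, hAl, hlc, hll, Nat.cast_one,
      Nat.cast_zero]
    rfl
  rw [hset, hν.measure_forall_encard_eq hAm hAd hAf, Fin.prod_univ_castSucc, ← mul_assoc]
  simp only [hAc, hAl, hlc, hll, poissonMeasure_singleton]
  refine mul_le_mul' ?_ ?_
  · rw [← Fin.prod_const, ← Finset.prod_mul_distrib]
    refine Finset.prod_le_prod' fun i _ => ?_
    set r := (spaceTimeIntensity (cell k (c i))).toNNReal with hr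
    have hcell : spaceTimeIntensity (cell k (c i)) = ENNReal.ofReal r := by
      rw [ENNReal.ofReal_coe_nnreal, hr, ENNReal.coe_toNNReal (hfc i)]
    have hrm : (r : ℝ) ≤ mesh k := by
      have := spaceTimeIntensity_cell_le k (c i)
      rwa [hcell, ENNReal.ofReal_le_ofReal_iff (mesh_pos k).le] at this
    rw [hcell, ← ENNReal.ofReal_mul r.coe_nonneg]
    refine ENNReal.ofReal_le_ofReal ?_
    rw [pow_one, Nat.factorial_one, Nat.cast_one, div_one, mul_comm]
    exact mul_le_mul_of_nonneg_right (Real.exp_le_exp.2 (neg_le_neg hrm)) r.coe_nonneg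
  · refine (voidProb_anti (sdiff_subset (t := ⋃ i, cell k (c i))) hDfin).trans ?_
    simp [voidProb, ENNReal.coe_toNNReal_eq_toReal]

/-- The event that the first `n` customers are found in admissible cells of level `k`, whose places
lie in `B`. -/
def goodEvent (ν : Ω → Set (ℝ × ℝ)) (n k : ℕ) (B : Set (Fin n → ℝ)) : Set Ω :=
  ⋃ c ∈ {c : Fin n → ℤ × ℤ | IsCellAdmissible k c ∧
    ∀ p, (∀ i, cellOf k (p i) = c i) → places p ∈ B}, cellEvent ν k c

lemma measurableSet_goodEvent (hν : IsPoissonProcess ν spaceTimeIntensity P) (n k : ℕ)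
    (B : Set (Fin n → ℝ)) : MeasurableSet (goodEvent ν n k B) :=
  MeasurableSet.biUnion (to_countable _) fun c _ => measurableSet_cellEvent hν k c

/-- A lower bound of the density of the customers, constant on cells. -/
def cellDensity {n : ℕ} (k : ℕ) (B : Set (Fin n → ℝ)) (c : Fin n → ℤ × ℤ) : ℝ≥0∞ :=
  {c : Fin n → ℤ × ℤ | IsCellAdmissible k c ∧
    ∀ p, (∀ i, cellOf k (p i) = c i) → places p ∈ B}.indicator
    (fun c => ENNReal.ofReal (Real.exp (-mesh k)) ^ n *
      voidProb (explored (3 * mesh k) n (path (cornerPlaces k c)))) c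

lemma measurable_cellOf_pi (n k : ℕ) :
    Measurable fun (p : Fin n → ℝ × ℝ) i => cellOf k (p i) :=
  measurable_pi_iff.2 fun i => (measurable_cellOf k).comp (measurable_pi_apply i)

/-- The integral is a countable sum over tuples of cells, bounded term by term by the probabilities
of disjoint events. -/
lemma lintegral_cellDensity_le (hν : IsPoissonProcess ν spaceTimeIntensity P) {n : ℕ} (k : ℕ)
    (B : Set (Fin n → ℝ)) :
    ∫⁻ p, cellDensity k B (fun i => cellOf k (p i)) ∂(Measure.pi fun _ => spaceTimeIntensity) ≤
      P (goodEvent ν n k B) := by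
  rw [← lintegral_map (f := cellDensity k B) .of_discrete (measurable_cellOf_pi n k),
    lintegral_countable', goodEvent, measure_biUnion (to_countable _)
      (fun c hc c' hc' hne => disjoint_left.2 fun ω h h' =>
        hne (cellEvent_eq_of_mem hc.1 hc'.1 h h')) fun c _ => measurableSet_cellEvent hν k c,
    tsum_subtype {c : Fin n → ℤ × ℤ | IsCellAdmissible k c ∧
      ∀ p, (∀ i, cellOf k (p i) = c i) → places p ∈ B} fun c => P (cellEvent ν k c)]
  refine ENNReal.tsum_le_tsum fun c => ?_
  have hpre : (fun (p : Fin n → ℝ × ℝ) i => cellOf k (p i)) ⁻¹' {c} =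
      univ.pi fun i => cell k (c i) := by
    ext p
    simp only [mem_preimage, mem_singleton_iff, funext_iff, Set.mem_pi, mem_univ, forall_true_left]
    rfl
  rw [Measure.map_apply (measurable_cellOf_pi n k) (measurableSet_singleton c), hpre,
    Measure.pi_pi, cellDensity]
  by_cases hc : c ∈ {c : Fin n → ℤ × ℤ | IsCellAdmissible k c ∧
    ∀ p, (∀ i, cellOf k (p i) = c i) → places p ∈ B}
  · rw [indicator_of_mem hc, indicator_of_mem hc, mul_comm]
    exact le_measure_cellEvent hν hc.1
  · rw [indicator_of_notMem hc, zero_mul]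
    exact zero_le

end Poisson

/-! ### Refinement of the cells -/

lemma tendsto_voidProb_explored (n : ℕ) (x : ℕ → ℝ) :
    Tendsto (fun k => voidProb (explored (6 * mesh k) n x)) atTop
      (𝓝 (voidProb (explored 0 n x))) := by
  have hanti : Antitone fun k => explored (6 * mesh k) n x := fun k l hkl =>
    explored_mono (by
      have : mesh l ≤ mesh k := Nat.one_div_le_one_div hkl
      linarith) le_rfl x
  have hinter : ⋂ k, explored (6 * mesh k) n x = explored 0 n x := by
    refine Subset.antisymm (fun q hq => ?_) (subset_iInter fun k =>
      explored_mono (by linarith [mesh_pos k]) le_rfl x)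
    by_contra hcon
    have hev : ∀ᶠ k in atTop, ∀ i ∈ Finset.range n,
        ¬ (|q.1 - x i| ≤ |x (i + 1) - x i| + 6 * mesh k ∧ q.2 ≤ i) := by
      rw [eventually_all_finset]
      intro i hi
      have hi' : ¬ (|q.1 - x i| ≤ |x (i + 1) - x i| + 0 ∧ q.2 ≤ i) := fun h =>
        hcon ⟨i, Finset.mem_range.1 hi, h⟩
      rw [not_and_or] at hi'
      rcases hi' with h | h
      · have ht : Tendsto (fun k => |x (i + 1) - x i| + 6 * mesh k) atTop
            (𝓝 (|x (i + 1) - x i| + 0)) := by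
          simpa using (tendsto_mesh.const_mul 6).const_add |x (i + 1) - x i|
        filter_upwards [ht.eventually_lt_const (not_le.1 h)] with k hk hle
        exact absurd hle.1 (not_le.2 hk)
      · exact Eventually.of_forall fun k hle => h hle.2
    obtain ⟨k, hk⟩ := hev.exists
    obtain ⟨i, hi, h⟩ := mem_iInter.1 hq k
    exact hk i (Finset.mem_range.2 hi) h
  have hm := tendsto_measure_iInter_atTop (μ := spaceTimeIntensity)
    (fun k => (measurableSet_explored (6 * mesh k) n x).nullMeasurableSet) hanti
    ⟨0, (spaceTimeIntensity_explored_lt_top _ n x).ne⟩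
  rw [hinter] at hm
  have hr := (ENNReal.tendsto_toReal (spaceTimeIntensity_explored_lt_top 0 n x).ne).comp hm
  exact ENNReal.tendsto_ofReal ((Real.continuous_exp.tendsto _).comp hr.neg)

/-- Being unexplored is a finite set of strict inequalities, so it survives a small enlargement. The
constant `8` is `4` for the required room, `3` for moving the path and `1` for moving the point. -/
lemma eventually_isCellAdmissible {n : ℕ} {p : Fin n → ℝ × ℝ} (hp : IsAdmissible p) :
    ∀ᶠ k in atTop, IsCellAdmissible k fun i => cellOf k (p i) := by
  refine eventually_all.2 fun i => ?_
  have ht : ((⌈(p i).2⌉ : ℤ) : ℝ) ≤ (i : ℕ) := by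
    exact_mod_cast Int.ceil_le.2 (by exact_mod_cast (hp i).1)
  have hev : ∀ᶠ k in atTop, ∀ j ∈ Finset.range i, ¬ (|(p i).1 - path (places p) j| ≤
      |path (places p) (j + 1) - path (places p) j| + 8 * mesh k ∧ (p i).2 ≤ j) := by
    rw [eventually_all_finset]
    intro j hj
    have hj' : ¬ (|(p i).1 - path (places p) j| ≤
        |path (places p) (j + 1) - path (places p) j| + 0 ∧ (p i).2 ≤ j) := fun h =>
      (hp i).2 ⟨j, Finset.mem_range.1 hj, h⟩
    rw [not_and_or] at hj'
    rcases hj' with h | h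
    · have ht : Tendsto (fun k => |path (places p) (j + 1) - path (places p) j| + 8 * mesh k) atTop
          (𝓝 (|path (places p) (j + 1) - path (places p) j| + 0)) := by
        simpa using (tendsto_mesh.const_mul 8).const_add
          |path (places p) (j + 1) - path (places p) j|
      filter_upwards [ht.eventually_lt_const (not_le.1 h)] with k hk hle
      exact absurd hle.1 (not_le.2 hk)
    · exact Eventually.of_forall fun k hle => h hle.2
  filter_upwards [hev] with k hk
  refine ⟨ht, fun hmem => ?_⟩
  have hsub : ∀ m, |path (cornerPlaces k fun i => cellOf k (p i)) m - path (places p) m| ≤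
      mesh k := fun m => by
    rw [abs_sub_comm]; exact abs_path_places_sub_le (fun _ => rfl) m
  obtain ⟨j, hj, hd, hjt⟩ := explored_subset hsub hmem
  refine hk j (Finset.mem_range.2 hj) ⟨?_, (Int.le_ceil _).trans hjt⟩
  have h2 := abs_sub_le (p i).1 (corner k (cellOf k (p i))).1 (path (places p) j)
  linarith [abs_sub_corner_le k (p i)]

lemma servedDensity_le_liminf {n : ℕ} {B : Set (Fin n → ℝ)} (hB : IsOpen B)
    {p : Fin n → ℝ × ℝ} (hpB : places p ∈ B) :
    servedDensity p ≤ liminf (fun k => cellDensity k B fun i => cellOf k (p i)) atTop := by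
  by_cases hp : IsAdmissible p
  swap
  · rw [servedDensity_of_not_isAdmissible hp]; exact zero_le
  rw [servedDensity_of_isAdmissible hp]
  have hexp : Tendsto (fun k => ENNReal.ofReal (Real.exp (-mesh k)) ^ n) atTop (𝓝 1) := by
    have h1 : Tendsto (fun k => ENNReal.ofReal (Real.exp (-mesh k))) atTop (𝓝 1) := by
      have := ENNReal.tendsto_ofReal ((Real.continuous_exp.tendsto _).comp tendsto_mesh.neg)
      simpa using this
    simpa using ENNReal.Tendsto.pow (n := n) h1
  have hlim : Tendsto (fun k => ENNReal.ofReal (Real.exp (-mesh k)) ^ n *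
      voidProb (explored (6 * mesh k) n (path (places p)))) atTop
      (𝓝 (voidProb (explored 0 n (path (places p))))) := by
    simpa using ENNReal.Tendsto.mul hexp (Or.inl one_ne_zero)
      (tendsto_voidProb_explored n (path (places p))) (Or.inr ENNReal.one_ne_top)
  -- Openness of `B` enters here: points of a common cell have places within `2 * mesh k` of each
  -- other.
  have hin : ∀ᶠ k in atTop, ∀ p', (∀ i, cellOf k (p' i) = cellOf k (p i)) → places p' ∈ B := by
    obtain ⟨ε, hε, hball⟩ := Metric.isOpen_iff.1 hB _ hpB
    have h2 : Tendsto (fun k => 2 * mesh k) atTop (𝓝 0) := by simpa using tendsto_mesh.const_mul 2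
    filter_upwards [h2.eventually_lt_const hε] with k hk p' hp'
    refine hball (Metric.mem_ball.2 (((dist_pi_le_iff (by linarith [mesh_pos k])).2
      fun i => ?_).trans_lt hk))
    rw [Real.dist_eq]
    have h3 := abs_sub_corner_le k (p' i)
    have h4 := abs_sub_corner_le k (p i)
    rw [hp' i] at h3
    rw [abs_sub_comm] at h4
    have h5 := abs_sub_le (p' i).1 (corner k (cellOf k (p i))).1 (p i).1
    simp only [places]
    linarith
  rw [← hlim.liminf_eq]
  refine liminf_le_liminf ?_
  filter_upwards [eventually_isCellAdmissible hp, hin] with k hk1 hk2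
  rw [cellDensity, indicator_of_mem (s := {c : Fin n → ℤ × ℤ | IsCellAdmissible k c ∧
    ∀ p, (∀ i, cellOf k (p i) = c i) → places p ∈ B}) ⟨hk1, hk2⟩]
  refine mul_le_mul_right (voidProb_anti ?_ (spaceTimeIntensity_explored_lt_top _ n _).ne) _
  have := explored_subset (r := 3 * mesh k) (n := n) (δ := mesh k)
    (x := path (cornerPlaces k fun i => cellOf k (p i))) (y := path (places p)) fun m => by
      rw [abs_sub_comm]; exact abs_path_places_sub_le (fun _ => rfl) m
  rwa [show 3 * mesh k + 3 * mesh k = 6 * mesh k by ring] at this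

/-- The density bounds the law of the places of the customers from below on open sets. -/
lemma lintegral_servedDensity_le_liminf {Ω : Type*} [MeasurableSpace Ω] {P : Measure Ω}
    {ν : Ω → Set (ℝ × ℝ)} (hν : IsPoissonProcess ν spaceTimeIntensity P) {n : ℕ}
    {B : Set (Fin n → ℝ)} (hB : IsOpen B) :
    ∫⁻ p, servedDensity p * B.indicator 1 (places p)
      ∂(Measure.pi fun _ => spaceTimeIntensity) ≤
      liminf (fun k => P (goodEvent ν n k B)) atTop := by
  calc _ ≤ ∫⁻ p, liminf (fun k => cellDensity k B fun i => cellOf k (p i)) atTop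
        ∂(Measure.pi fun _ => spaceTimeIntensity) := by
        refine lintegral_mono fun p => ?_
        by_cases hp : places p ∈ B
        · simpa [hp] using servedDensity_le_liminf hB hp
        · simp [hp]
    _ ≤ liminf (fun k => ∫⁻ p, cellDensity k B (fun i => cellOf k (p i))
        ∂(Measure.pi fun _ => spaceTimeIntensity)) atTop :=
        lintegral_liminf_le fun k =>
          (Measurable.of_discrete (f := cellDensity k B)).comp (measurable_cellOf_pi n k)
    _ ≤ _ := liminf_le_liminf (Eventually.of_forall fun k => lintegral_cellDensity_le hν k B)

/-! ### The law of the places of the server -/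

lemma exists_of_mem_goodEvent {Ω : Type*} {ν : Ω → Set (ℝ × ℝ)} {n k : ℕ} {B : Set (Fin n → ℝ)} {ω : Ω}
    (hω : ω ∈ goodEvent ν n k B) : ∃ (c : Fin n → ℤ × ℤ) (p : Fin n → ℝ × ℝ),
      IsCellAdmissible k c ∧ ω ∈ cellEvent ν k c ∧ IsServed (ν ω) p ∧
      (∀ i, cellOf k (p i) = c i) ∧ places p ∈ B := by
  simp only [goodEvent, mem_iUnion, exists_prop] at hω
  obtain ⟨c, ⟨hc, hB⟩, hω⟩ := hω
  obtain ⟨p, hp, hpc⟩ := exists_isServed hc hω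
  exact ⟨c, p, hc, hω, hp, hpc, hB p hpc⟩

section Server

variable {Ω : Type*} [MeasurableSpace Ω] {P : Measure Ω} {ν : Ω → Set (ℝ × ℝ)}

variable [IsProbabilityMeasure P]

/-- With `B = univ` the lower bound is the full mass one, so no separate upper bound is needed. -/
lemma tendsto_measure_goodEvent_compl (hν : IsPoissonProcess ν spaceTimeIntensity P) {n : ℕ}
    (hmass : ∫⁻ p : Fin n → ℝ × ℝ, servedDensity p ∂(Measure.pi fun _ => spaceTimeIntensity) = 1) :
    Tendsto (fun k => P (goodEvent ν n k univ)ᶜ) atTop (𝓝 0) := by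
  have h1 : Tendsto (fun k => P (goodEvent ν n k univ)) atTop (𝓝 1) := by
    refine tendsto_of_le_liminf_of_limsup_le ?_ ?_
    · have := lintegral_servedDensity_le_liminf hν (n := n) isOpen_univ
      simpa [hmass] using this
    · exact limsup_le_of_le (by isBoundedDefault) (Eventually.of_forall fun k => prob_le_one)
  have h2 : ∀ k, P (goodEvent ν n k univ)ᶜ = 1 - P (goodEvent ν n k univ) := fun k =>
    prob_compl_eq_one_sub (measurableSet_goodEvent hν n k univ)
  simp only [h2]
  simpa using ENNReal.Tendsto.sub (tendsto_const_nhds (x := (1 : ℝ≥0∞))) h1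
    (Or.inl ENNReal.one_ne_top)

lemma ae_existsUnique_isNearest (hν : IsPoissonProcess ν spaceTimeIntensity P)
    (hmass : ∀ n, ∫⁻ p : Fin n → ℝ × ℝ, servedDensity p
      ∂(Measure.pi fun _ => spaceTimeIntensity) = 1) :
    ∀ᵐ ω ∂P, ∀ n : ℕ, ∃! p : ℝ × ℝ,
      IsNearest (ν ω) (serverState (ν ω) n).2 n (serverState (ν ω) n).1 p := by
  rw [ae_all_iff]
  intro n
  rw [ae_iff]
  -- Failure at time `n` is contained in the complement of the good event for `n + 1` customers at
  -- every level.
  refine le_antisymm (ge_of_tendsto' (tendsto_measure_goodEvent_compl hν (hmass (n + 1)))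
    fun k => measure_mono fun ω hω hgood => hω ?_) zero_le
  obtain ⟨c, p, -, -, hp, -, -⟩ := exists_of_mem_goodEvent hgood
  exact ⟨p (Fin.last n), (hp.isNearest_iff (Fin.last n) _).2 rfl,
    fun q hq => (hp.isNearest_iff (Fin.last n) q).1 hq⟩

/-- The greedy rule is defined by choice, so measurability is obtained from a limit in measure:
measurable functions giving the corners of the cells are within `mesh k` of the places on the good
event. -/
lemma aemeasurable_serverPlaces (hν : IsPoissonProcess ν spaceTimeIntensity P) {n : ℕ}
    (hmass : ∫⁻ p : Fin n → ℝ × ℝ, servedDensity p ∂(Measure.pi fun _ => spaceTimeIntensity) = 1) :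
    AEMeasurable (fun ω => serverPlaces (ν ω) n) P := by
  have hex : ∀ k, ∃ Y : Ω → Fin n → ℝ, Measurable Y ∧ ∀ c : Fin n → ℤ × ℤ,
      EqOn Y (fun _ => cornerPlaces k c) {ω | IsCellAdmissible k c ∧ ω ∈ cellEvent ν k c} := by
    intro k
    refine exists_measurable_piecewise _ (fun c => ?_) _ (fun c => measurable_const) ?_
    · by_cases hc : IsCellAdmissible k c
      · simpa [hc] using measurableSet_cellEvent hν k c
      · simp [hc]
    · rintro c c' hcc ω ⟨h, h'⟩
      exact absurd (cellEvent_eq_of_mem h.1 h'.1 h.2 h'.2) hcc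
  choose Y hY hYc using hex
  refine TendstoInMeasure.aemeasurable (u := atTop) (fun k => (hY k).aemeasurable) ?_
  rw [tendstoInMeasure_iff_dist]
  intro ε hε
  refine tendsto_of_tendsto_of_tendsto_of_le_of_le' tendsto_const_nhds
    (tendsto_measure_goodEvent_compl hν hmass) (Eventually.of_forall fun _ => zero_le) ?_
  filter_upwards [tendsto_mesh.eventually_lt_const hε] with k hk
  refine measure_mono fun ω hω hgood => ?_
  obtain ⟨c, p, hc, hωc, hp, hpc, -⟩ := exists_of_mem_goodEvent hgood
  have hle : dist (Y k ω) (serverPlaces (ν ω) n) ≤ mesh k := by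
    rw [hYc k c ⟨hc, hωc⟩, hp.serverPlaces_eq]
    refine (dist_pi_le_iff (mesh_pos k).le).2 fun i => ?_
    rw [Real.dist_eq, abs_sub_comm]
    change |(p i).1 - (corner k (c i)).1| ≤ mesh k
    rw [← hpc i]
    exact abs_sub_corner_le k (p i)
  have hge : ε ≤ dist (Y k ω) (serverPlaces (ν ω) n) := hω
  linarith

lemma map_serverPlaces_eq (hν : IsPoissonProcess ν spaceTimeIntensity P) {n : ℕ}
    {μ : Measure (Fin n → ℝ)} [IsProbabilityMeasure μ]
    (hμ : ∀ g : (Fin n → ℝ) → ℝ≥0∞, Measurable g → ∫⁻ x, g x ∂μ =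
      ∫⁻ p, servedDensity p * g (places p) ∂(Measure.pi fun _ => spaceTimeIntensity)) :
    AEMeasurable (fun ω => serverPlaces (ν ω) n) P ∧
      P.map (fun ω => serverPlaces (ν ω) n) = μ := by
  have hmass : ∫⁻ p : Fin n → ℝ × ℝ, servedDensity p
      ∂(Measure.pi fun _ => spaceTimeIntensity) = 1 := by
    simpa using (hμ (fun _ => 1) measurable_const).symm
  have hm := aemeasurable_serverPlaces hν hmass
  refine ⟨hm, ?_⟩
  have := Measure.isProbabilityMeasure_map (μ := P) hm
  have hopen : ∀ B : Set (Fin n → ℝ), IsOpen B → μ B ≤ P.map (fun ω => serverPlaces (ν ω) n) B := by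
    intro B hB
    rw [Measure.map_apply_of_aemeasurable hm hB.measurableSet,
      ← lintegral_indicator_one hB.measurableSet,
      hμ _ (measurable_one.indicator hB.measurableSet)]
    refine (lintegral_servedDensity_le_liminf hν hB).trans ?_
    refine liminf_le_of_le (by isBoundedDefault) fun b hb => ?_
    obtain ⟨k, hk⟩ := hb.exists
    refine hk.trans (measure_mono fun ω hω => ?_)
    obtain ⟨c, p, -, -, hp, -, hpB⟩ := exists_of_mem_goodEvent hω
    rw [mem_preimage, hp.serverPlaces_eq]
    exact hpB
  set μ' : ProbabilityMeasure (Fin n → ℝ) := ⟨μ, inferInstance⟩ with hμ'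
  set ρ : ProbabilityMeasure (Fin n → ℝ) := ⟨P.map fun ω => serverPlaces (ν ω) n, this⟩ with hρ
  -- Domination on open sets is the portmanteau criterion for the constant sequence `ρ` to converge
  -- to `μ'`; uniqueness of limits then gives equality.
  have hlim : Tendsto (fun _ : ℕ => ρ) atTop (𝓝 μ') := by
    refine tendsto_of_forall_isOpen_le_liminf' fun B hB => ?_
    rw [liminf_const]
    exact hopen B hB
  have heq : ρ = μ' := tendsto_nhds_unique tendsto_const_nhds hlim
  exact congrArg (fun m : ProbabilityMeasure (Fin n → ℝ) => (m : Measure (Fin n → ℝ))) heq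

end Server

/-! ### Independence of the driving sequences -/

lemma comap_prod_eq_generateFrom {X α β : Type*} [MeasurableSpace α] [MeasurableSpace β]
    (F : X → α × β) : MeasurableSpace.comap F Prod.instMeasurableSpace =
      MeasurableSpace.generateFrom
        (preimage F '' image2 (· ×ˢ ·) {s | MeasurableSet s} {t | MeasurableSet t}) := by
  rw [← MeasurableSpace.comap_generateFrom, generateFrom_prod]

section Driving

variable {Ω' : Type*} [MeasurableSpace Ω'] {Q : Measure Ω'} [IsProbabilityMeasure Q]

/-- On rectangles, a π-system generating the product σ-algebra, the joint probability factors into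
four. -/
lemma IndepFun.prodMk_prodMk {α α' β β' : Type*} [MeasurableSpace α] [MeasurableSpace α']
    [MeasurableSpace β] [MeasurableSpace β'] {f : Ω' → α} {f' : Ω' → α'} {g : Ω' → β}
    {g' : Ω' → β'} (hf : Measurable f) (hf' : Measurable f') (hg : Measurable g)
    (hg' : Measurable g') (hff : IndepFun f f' Q) (hgg : IndepFun g g' Q)
    (hfg : IndepFun (fun ω => (f ω, f' ω)) (fun ω => (g ω, g' ω)) Q) :
    IndepFun (fun ω => (f ω, g ω)) (fun ω => (f' ω, g' ω)) Q := by
  refine IndepSets.indep (hf.prodMk hg).comap_le (hf'.prodMk hg').comap_le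
    (isPiSystem_prod.comap _) (isPiSystem_prod.comap _) (comap_prod_eq_generateFrom _)
    (comap_prod_eq_generateFrom _) ?_
  rw [IndepSets_iff]
  rintro _ _ ⟨_, ⟨A, hA, B, hB, rfl⟩, rfl⟩ ⟨_, ⟨A', hA', B', hB', rfl⟩, rfl⟩
  have h1 := hfg.measure_inter_preimage_eq_mul _ _ (hA.prod hA') (hB.prod hB')
  have h2 := hfg.measure_inter_preimage_eq_mul _ _ (hA.prod .univ) (hB.prod .univ)
  have h3 := hfg.measure_inter_preimage_eq_mul _ _ (MeasurableSet.univ.prod hA')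
    (MeasurableSet.univ.prod hB')
  have h4 := hff.measure_inter_preimage_eq_mul _ _ hA hA'
  have h5 := hgg.measure_inter_preimage_eq_mul _ _ hB hB'
  simp only [mk_preimage_prod, preimage_univ, inter_univ, univ_inter] at h1 h2 h3
  simp only [mk_preimage_prod]
  rw [h2, h3, inter_inter_inter_comm, h1, h4, h5]
  ring

variable {E U : ℕ → Ω' → ℝ}

lemma map_chain_prod (hEm : ∀ n, Measurable (E n)) (hUm : ∀ n, Measurable (U n))
    (hE : ∀ n, Q.map (E n) = expMeasure 1) (hEindep : iIndepFun E Q)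
    (hU : ∀ n, Q.map (U n) = volume.restrict (Icc (0 : ℝ) 1)) (hUindep : iIndepFun U Q)
    (hEU : IndepFun (fun ω n => E n ω) (fun ω n => U n ω) Q) (n : ℕ) :
    Q.map (fun ω => (chain (fun k => (E k ω, U k ω)) n, (E n ω, U n ω))) =
      (Q.map fun ω => chain (fun k => (E k ω, U k ω)) n).prod
        ((expMeasure 1).prod (volume.restrict (Icc (0 : ℝ) 1))) := by
  set past : (ℕ → Ω' → ℝ) → Ω' → Finset.range n → ℝ := fun X ω i => X i ω with hpast
  have hpm : ∀ X : ℕ → Ω' → ℝ, (∀ n, Measurable (X n)) → Measurable (past X) := fun X hX =>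
    measurable_pi_iff.2 fun i => hX i
  have hsplit : ∀ X : ℕ → Ω' → ℝ, (∀ n, Measurable (X n)) → iIndepFun X Q →
      IndepFun (past X) (X n) Q := by
    intro X hX hind
    exact (hind.indepFun_finset (Finset.range n) {n} (by simp) hX).comp measurable_id
      (measurable_pi_apply (⟨n, Finset.mem_singleton_self n⟩ : ({n} : Finset ℕ)))
  have hsel : Measurable fun x : ℕ → ℝ => ((fun i : Finset.range n => x i), x n) :=
    (measurable_pi_iff.2 fun i => measurable_pi_apply _).prodMk (measurable_pi_apply n)
  have hind := IndepFun.prodMk_prodMk (hpm E hEm) (hEm n) (hpm U hUm) (hUm n)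
    (hsplit E hEm hEindep) (hsplit U hUm hUindep) (hEU.comp hsel hsel)
  classical
  -- The first `n` places depend on the first `n` pairs only, so the padding by `0` is harmless and
  -- the history is a function of the past.
  set rebuild : (Finset.range n → ℝ) × (Finset.range n → ℝ) → ℕ → ℝ × ℝ := fun a k =>
    if h : k ∈ Finset.range n then (a.1 ⟨k, h⟩, a.2 ⟨k, h⟩) else 0 with hrebuild
  have hrm : Measurable rebuild := by
    refine measurable_pi_iff.2 fun k => ?_
    by_cases h : k ∈ Finset.range n
    · simp only [hrebuild, h, dite_true]; fun_prop
    · simp only [hrebuild, h, dite_false]; fun_prop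
  have hchain : ∀ ω, chain (rebuild (past E ω, past U ω)) n =
      chain (fun k => (E k ω, U k ω)) n := fun ω => chain_congr fun i hi => by
    simp [hrebuild, hpast, hi]
  have hc : IndepFun (fun ω => chain (fun k => (E k ω, U k ω)) n) (fun ω => (E n ω, U n ω)) Q := by
    have := hind.comp ((measurable_chain n).comp hrm) measurable_id
    simpa only [Function.comp_def, hchain, id] using this
  have hW : Measurable fun ω k => (E k ω, U k ω) :=
    measurable_pi_iff.2 fun k => (hEm k).prodMk (hUm k)
  have hcm : Measurable fun ω => chain (fun k => (E k ω, U k ω)) n := (measurable_chain n).comp hW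
  have hprod : Q.map (fun ω => (E n ω, U n ω)) =
      (expMeasure 1).prod (volume.restrict (Icc (0 : ℝ) 1)) := by
    rw [(indepFun_iff_map_prod_eq_prod_map_map (hEm n).aemeasurable (hUm n).aemeasurable).1
      (hEU.comp (measurable_pi_apply n) (measurable_pi_apply n)), hE, hU]
  rw [← hprod]
  exact (indepFun_iff_map_prod_eq_prod_map_map hcm.aemeasurable
    ((hEm n).prodMk (hUm n)).aemeasurable).1 hc

end Driving

/-- Every finite index set lies in an initial segment, and a projective limit of finite measures is
unique. -/
lemma map_seq_eq_of_forall_fin {Ω Ω' : Type*} [MeasurableSpace Ω] [MeasurableSpace Ω']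
    {P : Measure Ω} [IsProbabilityMeasure P] {Q : Measure Ω'} {X : Ω → ℕ → ℝ} {Y : Ω' → ℕ → ℝ}
    (hX : AEMeasurable X P) (hY : AEMeasurable Y Q)
    (h : ∀ n, P.map (fun ω (i : Fin n) => X ω i) = Q.map (fun ω (i : Fin n) => Y ω i)) :
    P.map X = Q.map Y := by
  have hXi : ∀ i, AEMeasurable (fun ω => X ω i) P := aemeasurable_pi_iff.1 hX
  have hYi : ∀ i, AEMeasurable (fun ω => Y ω i) Q := aemeasurable_pi_iff.1 hY
  have h1 := isProjectiveLimit_map (X := fun i ω => X ω i) hX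
  have h2 := isProjectiveLimit_map (X := fun i ω => Y ω i) hY
  refine h1.unique fun I => ?_
  rw [h2 I]
  obtain ⟨n, hn⟩ := I.exists_nat_subset_range
  have hf : Measurable fun (x : Fin n → ℝ) (i : I) => x ⟨i, Finset.mem_range.1 (hn i.2)⟩ :=
    measurable_pi_iff.2 fun i => measurable_pi_apply _
  have := congrArg (Measure.map fun (x : Fin n → ℝ) (i : I) =>
    x ⟨i, Finset.mem_range.1 (hn i.2)⟩) (h n)
  rw [AEMeasurable.map_map_of_aemeasurable hf.aemeasurable
    (aemeasurable_pi_iff.2 fun i : Fin n => hXi i),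
    AEMeasurable.map_map_of_aemeasurable hf.aemeasurable
    (aemeasurable_pi_iff.2 fun i : Fin n => hYi i)] at this
  exact this.symm

end GreedyServer

end

theorem lemma1
    {Ω Ω' : Type*} [MeasurableSpace Ω] [MeasurableSpace Ω']
    (P : Measure Ω) [IsProbabilityMeasure P] (Q : Measure Ω') [IsProbabilityMeasure Q]
    (ν : Ω → Set (ℝ × ℝ))
    (hν : GreedyServer.IsPoissonProcess ν GreedyServer.spaceTimeIntensity P)
    (E U : ℕ → Ω' → ℝ)
    (hE : ∀ n, HasLaw (E n) (expMeasure 1) Q) (hEindep : iIndepFun E Q)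
    (hU : ∀ n, HasLaw (U n) (volume.restrict (Icc (0 : ℝ) 1)) Q) (hUindep : iIndepFun U Q)
    (hEU : IndepFun (fun ω n => E n ω) (fun ω n => U n ω) Q) :
    -- almost surely the greedy rule always determines the next customer
    (∀ᵐ ω ∂P, ∀ n : ℕ, ∃! p : ℝ × ℝ,
      GreedyServer.IsNearest (ν ω) (GreedyServer.serverState (ν ω) n).2 n
        (GreedyServer.serverState (ν ω) n).1 p) ∧
    -- almost surely all the steps of the recursion of potentials are well defined
    (∀ᵐ ω ∂Q, ∀ n : ℕ,
      GreedyServer.IsPotential (GreedyServer.potentialSeq (fun k => (E k ω, U k ω)) n) ∧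
      ∃! z : ℝ, GreedyServer.IsRadius
        (GreedyServer.potentialSeq (fun k => (E k ω, U k ω)) n) (E n ω) z) ∧
    -- the sequences `(S_1, S_2, …)` and `(S_{1-}, S_{2-}, …)` have the same law
    IdentDistrib
      (fun ω (n : ℕ) => GreedyServer.argMax
        (GreedyServer.potentialSeq (fun k => (E k ω, U k ω)) (n + 1)))
      (fun ω (n : ℕ) => Function.leftLim (GreedyServer.serverPosition (ν ω)) ((n : ℝ) + 1))
      Q P := by
  open GreedyServer in
  -- `HasLaw` gives measurability only almost everywhere, so the chain is driven by measurable
  -- modifications.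
  set E' : ℕ → Ω' → ℝ := fun n => (hE n).aemeasurable.mk (E n) with hE'
  set U' : ℕ → Ω' → ℝ := fun n => (hU n).aemeasurable.mk (U n) with hU'
  have hEm : ∀ n, Measurable (E' n) := fun n => (hE n).aemeasurable.measurable_mk
  have hUm : ∀ n, Measurable (U' n) := fun n => (hU n).aemeasurable.measurable_mk
  have hEE : ∀ n, E n =ᵐ[Q] E' n := fun n => (hE n).aemeasurable.ae_eq_mk
  have hUU : ∀ n, U n =ᵐ[Q] U' n := fun n => (hU n).aemeasurable.ae_eq_mk
  have hW : Measurable fun ω k => (E' k ω, U' k ω) :=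
    measurable_pi_iff.2 fun k => (hEm k).prodMk (hUm k)
  have hpos : ∀ᵐ ω ∂Q, ∀ k, 0 < E k ω := by
    rw [ae_all_iff]
    intro k
    rw [ae_iff, (hE k).measure_eq (p := fun e => ¬ 0 < e) measurableSet_Ioi.compl]
    exact expMeasure_nonpos
  have hae : ∀ᵐ ω ∂Q, (fun k => (E k ω, U k ω)) = fun k => (E' k ω, U' k ω) := by
    filter_upwards [ae_all_iff.2 hEE, ae_all_iff.2 hUU] with ω h1 h2
    ext1 k
    rw [h1 k, h2 k]
  have hlaw := map_chain_prod hEm hUm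
    (fun n => by rw [← Measure.map_congr (hEE n), (hE n).map_eq]) (hEindep.congr hEE)
    (fun n => by rw [← Measure.map_congr (hUU n), (hU n).map_eq]) (hUindep.congr hUU)
    (hEU.congr (by filter_upwards [ae_all_iff.2 hEE] with ω h using funext h)
      (by filter_upwards [ae_all_iff.2 hUU] with ω h using funext h))
  have hcm : ∀ n, Measurable fun ω => chain (fun k => (E' k ω, U' k ω)) n := fun n =>
    (measurable_chain n).comp hW
  have hserver : ∀ n, AEMeasurable (fun ω => serverPlaces (ν ω) n) P ∧
      P.map (fun ω => serverPlaces (ν ω) n) =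
        Q.map fun ω => chain (fun k => (E' k ω, U' k ω)) n := by
    intro n
    have := Measure.isProbabilityMeasure_map (μ := Q) (hcm n).aemeasurable
    refine map_serverPlaces_eq hν fun g hg => ?_
    rw [lintegral_map hg (hcm n)]
    exact lintegral_chain hW hlaw n hg
  -- The chain on `Ω'` supplies the normalisation used for the server on `Ω`.
  have hmass : ∀ n, ∫⁻ p : Fin n → ℝ × ℝ, servedDensity p
      ∂(Measure.pi fun _ => spaceTimeIntensity) = 1 := fun n => by
    simpa using (lintegral_chain hW hlaw n (g := fun _ => 1) measurable_const).symm
  have hchain : ∀ n, (fun ω (i : Fin n) => argMax (potentialSeq (fun k => (E k ω, U k ω)) (i + 1)))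
      =ᵐ[Q] fun ω => chain (fun k => (E' k ω, U' k ω)) n := by
    intro n
    filter_upwards [hpos, hae] with ω h1 h2
    ext i
    rw [argMax_potentialSeq h1, h2]
  have hplaces : (fun ω (n : ℕ) => Function.leftLim (serverPosition (ν ω)) ((n : ℝ) + 1)) =
      fun ω n => (serverState (ν ω) (n + 1)).1 := by
    ext ω n
    exact leftLim_serverPosition _ _
  refine ⟨ae_existsUnique_isNearest hν hmass, ?_, ?_⟩
  · filter_upwards [hpos] with ω h n using potentialSeq_wellDefined (w := fun k => (E k ω, U k ω)) h n
  · rw [hplaces]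
    have hS : AEMeasurable (fun ω (n : ℕ) => argMax
        (potentialSeq (fun k => (E k ω, U k ω)) (n + 1))) Q := aemeasurable_pi_iff.2 fun n =>
      aemeasurable_pi_iff.1 ((hcm (n + 1)).aemeasurable.congr (hchain (n + 1)).symm) (Fin.last n)
    have hT : AEMeasurable (fun ω (n : ℕ) => (serverState (ν ω) (n + 1)).1) P :=
      aemeasurable_pi_iff.2 fun n => aemeasurable_pi_iff.1 (hserver (n + 1)).1 (Fin.last n)
    refine ⟨hS, hT, map_seq_eq_of_forall_fin hS hT fun n => ?_⟩
    rw [Measure.map_congr (hchain n), ← (hserver n).2]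
    rfl
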